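/- Let $\mathcal I_n$ be the set of involutions of $\{1,\dots,n\}$ (permutations with $\pi^{-1}=\pi$; $n\ge 0$), and let $T=\{12,21\}$. An occurrence of $12$ (resp. $21$) in a word of distinct positive integers is a factor (two adjacent entries) of the form $a\,(a+1)$ (resp. $(a+1)\,a$). In an involution $\pi$, the sibling of the occurrence $\pi_j\pi_{j+1}$ is the occurrence formed by the symbols $j,j+1$. Let $\tau(\pi)$ be the number of occurrences of $\tau$ in $\pi$, $\tau^{sib}(\pi)$ the number of those that coincide with their sibling, and $\tau^{nsib}(\pi)$ the number of those that do not. Let $\mathrm{fp}(\pi)$ be the number of fixed points of $\pi$. A $T$-marked word is a pair $(w,M)$ where $w$ is a word of distinct positive integers and $M$ is a set of occurrences of $12$ and $21$ in $w$; it is the concatenation of non-empty $T$-marked words $(\alpha,M_1)$ and $(\beta,M_2)$ if $w=\alpha\beta$ and $M=M_1\cup M_2$. A $T$-cluster is a $T$-marked word that is not such a concatenation and whose word is a permutation of $\{1,\dots,n\}$ with $n\ge 2$; it is involutory if this permutation is an involution. Put $$C(x,a_1,a_2)=\sum_{(\pi,M)}x^{|\pi|}a_1^{12(\pi)}a_2^{21(\pi)}$$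 (sum over all $T$-clusters), $$CI(x,t,u_1,u_2,\bar u_1,\bar u_2)=\sum_{(\pi,M)}x^{|\pi|}t^{\mathrm{fp}(\pi)}u_1^{12^{sib}(\pi)}u_2^{21^{sib}(\pi)}\bar u_1^{12^{nsib}(\pi)}\bar u_2^{21^{nsib}(\pi)}$$ (sum over all involutory $T$-clusters), and let $F(x,t,u_1,u_2,\bar u_1,\bar u_2)$ be the sum of the same monomials over all $\pi\in\bigcup_{n\ge0}\mathcal I_n$. These are formal power series in $x$; the other variables may be taken to be arbitrary elements of a commutative ring. Then the following hold. 1. The $T$-clusters are exactly $(12\cdots n,\{12,23,\dots,(n-1)n\})$ and $(n\cdots21,\{n(n-1),\dots,32,21\})$ for $n\ge2$. In particular every $T$-cluster is involutory. 2. $C(x,a_1,a_2)=CI(x,1,a_1,a_2,a_1,a_2)$, and $$CI(x,t,u_1,u_2,\bar u_1,\bar u_2)=\frac{x^2t^2u_1}{1-xtu_1}+\frac{(u_2+xt\bar u_2^2)x^2}{1-x^2\bar u_2^2}.$$ 3. As a formal continued fraction (each coefficient of $x^n$ of the convergents is eventually constant, equal to that of $F$), $$F(x,t,u_1,u_2,\bar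 u_1,\bar u_2)=\cfrac{1}{1-A-\cfrac{B}{1-A-\cfrac{2B}{1-A-\cfrac{3B}{\ldots}}}},$$ where $$A=xt+\frac{x^2t^2(u_1-1)}{1-xt(u_1-1)}+\frac{(u_2-1+xt(\bar u_2^2-1))x^2}{1-x^2(\bar u_2^2-1)},$$ $$B=x^2+\frac{x^4(\bar u_1^2-1)}{1-x^2(\bar u_1^2-1)}+\frac{(\bar u_2^2-1+x^2(\bar u_2^2-1)^2)x^4}{1-x^4(\bar u_2^2-1)^2}=x^2+\frac{x^4(\bar u_1^2-1)}{1-x^2(\bar u_1^2-1)}+\frac{x^4(\bar u_2^2-1)}{1-x^2(\bar u_2^2-1)}.$$ 4. $F(x,1,0,0,0,0)=\sum_n h_nx^n$, where $h_n$ is the number of $\pi\in\mathcal I_n$ with $|\pi(i+1)-\pi(i)|\ne1$ for all $i$. $F(x,1,0,1,0,1)=\sum_n r_nx^n$, where $r_n$ is the number of irreducible $\pi\in\mathcal I_n$, i.e. those with $\pi(i+1)-\pi(i)\neq1$ for all $i$; and $F(x,0,0,1,0,1)$ is the generating function of the irreducible involutions without fixed points. Finally $F(x,0,1,u_2,1,1)=\sum_n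 x^n\sum_\pi u_2^{s(\pi)}$, where $\pi$ runs over the perfect matchings of $\{1,\dots,n\}$ (involutions without fixed points) and $s(\pi)$ is the number of short pairs, i.e. arcs connecting two consecutive elements $i,i+1$. -/

import Mathlib

open Finset PowerSeries
open Equiv (Perm)

namespace Hertzsprung

/-! ### Words, H-patterns and occurrences -/

/-- The word `π(1) π(2) … π(n)` (with letters `1, …, n`) of a permutation. -/
def oneLine {n : ℕ} (π : Perm (Fin n)) : List ℕ :=
  List.ofFn fun i => (π i : ℕ) + 1

/-- The occurrences of the H-pattern `τ ∈ S_k` in the word `w` of positive integers.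
The pair `(j, c)` stands for the factor of length `k` of `w` that starts after the first `j`
letters, and `c` is the constant such that the `i`-th letter of the factor minus `τ(i)` is `c`;
so the factor occupies the positions `j+1, …, j+k` and its letters are `c+1, …, c+k`.
(As `Fin k` is `0`-based, `τ(i)` is `τ i + 1`. Letters are positive, so `c` is never negative;
letters are at most `w.sum`, so the bounds on `j` and `c` exclude nothing.) -/
def occ {k : ℕ} (τ : Perm (Fin k)) (w : List ℕ) : Finset (ℕ × ℕ) :=
  (range (w.length + 1) ×ˢ range (w.sum + 1)).filter fun p =>
    ∀ i : Fin k, w[p.1 + (i : ℕ)]? = some (((τ i : ℕ) + 1) + p.2)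

/-- The occurrences in `w` of the patterns in a set `T` of H-patterns of the same length. -/
def occs {k : ℕ} (T : Finset (Perm (Fin k))) (w : List ℕ) : Finset (ℕ × ℕ) :=
  T.biUnion fun τ => occ τ w

/-- `τ(π)`, the number of occurrences of `τ` in `π`. -/
def count {k n : ℕ} (τ : Perm (Fin k)) (π : Perm (Fin n)) : ℕ :=
  (occ τ (oneLine π)).card

/-- The sibling, in an involution, of the occurrence at positions `j+1, …, j+k` with letters
`c+1, …, c+k` is the factor formed by the letters `j+1, …, j+k`; it is located at the positions
`c+1, …, c+k`. -/
def sibling (p : ℕ × ℕ) : ℕ × ℕ := (p.2, p.1)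

/-- `τ^sib(π)`: the number of occurrences of `τ` that coincide with their sibling. -/
def countSib {k n : ℕ} (τ : Perm (Fin k)) (π : Perm (Fin n)) : ℕ :=
  ((occ τ (oneLine π)).filter fun p => sibling p = p).card

/-- `τ^nsib(π)`: the number of occurrences of `τ` that do not coincide with their sibling. -/
def countNsib {k n : ℕ} (τ : Perm (Fin k)) (π : Perm (Fin n)) : ℕ :=
  ((occ τ (oneLine π)).filter fun p => sibling p ≠ p).card

/-! ### Marked words and clusters -/

/-- `(w, M)` is a `T`-marked word: `w` is a word over the positive integers without repeated
letters and `M` is a set of occurrences in `w` of patterns from `T`. -/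
def IsMarkedWord {k : ℕ} (T : Finset (Perm (Fin k))) (w : List ℕ) (M : Finset (ℕ × ℕ)) : Prop :=
  w.Nodup ∧ (∀ a ∈ w, 0 < a) ∧ M ⊆ occs T w

/-- The `T`-marked word `(w, M)` is the concatenation of two non-empty `T`-marked words
`(α, M₁)` and `(β, M₂)`. The factors of `β` are shifted by `|α|` positions inside `w = αβ`. -/
def IsConcatenation {k : ℕ} (T : Finset (Perm (Fin k))) (w : List ℕ) (M : Finset (ℕ × ℕ)) :
    Prop :=
  ∃ (α β : List ℕ) (M₁ M₂ : Finset (ℕ × ℕ)), α ≠ [] ∧ β ≠ [] ∧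
    IsMarkedWord T α M₁ ∧ IsMarkedWord T β M₂ ∧
    w = α ++ β ∧ M = M₁ ∪ M₂.image fun p => (α.length + p.1, p.2)

/-- `(π, M)` is a `T`-cluster: a `T`-marked permutation of length at least two that is not the
concatenation of two non-empty `T`-marked words. -/
def IsCluster {k n : ℕ} (T : Finset (Perm (Fin k))) (π : Perm (Fin n)) (M : Finset (ℕ × ℕ)) :
    Prop :=
  2 ≤ n ∧ IsMarkedWord T (oneLine π) M ∧ ¬ IsConcatenation T (oneLine π) M

open Classical in
/-- The sets `M` for which `(π, M)` is a `T`-cluster. -/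
noncomputable def clusterMarkings {k n : ℕ} (T : Finset (Perm (Fin k))) (π : Perm (Fin n)) :
    Finset (Finset (ℕ × ℕ)) :=
  (occs T (oneLine π)).powerset.filter fun M => IsCluster T π M

/-! ### The patterns 12 and 21 and the generating functions -/

/-- The pattern `12`. -/
def p12 : Perm (Fin 2) := 1

/-- The pattern `21`. -/
def p21 : Perm (Fin 2) := Equiv.swap 0 1

/-- The set `T = {12, 21}`. -/
def T₂ : Finset (Perm (Fin 2)) := {p12, p21}

/-- The set `𝓘ₙ` of involutions of length `n` (permutations that are their own inverses). -/
def involutions (n : ℕ) : Finset (Perm (Fin n)) :=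
  univ.filter fun π => π⁻¹ = π

/-- The number of fixed points of `π`. -/
def fp {n : ℕ} (π : Perm (Fin n)) : ℕ :=
  (univ.filter fun i => π i = i).card

section GeneratingFunctions

variable {R : Type*} [CommRing R]

/-- The weight `t^fp(π) u₁^(12^sib(π)) u₂^(21^sib(π)) v₁^(12^nsib(π)) v₂^(21^nsib(π))`. -/
def weight (t u₁ u₂ v₁ v₂ : R) {n : ℕ} (π : Perm (Fin n)) : R :=
  t ^ fp π * (u₁ ^ countSib p12 π * u₂ ^ countSib p21 π) *
    (v₁ ^ countNsib p12 π * v₂ ^ countNsib p21 π)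

/-- The cluster generating function `C(x, a₁, a₂)` for `T = {12, 21}`, a power series in `x`. -/
noncomputable def clusterGF (a₁ a₂ : R) : R⟦X⟧ :=
  PowerSeries.mk fun n => ∑ π : Perm (Fin n), ∑ _M ∈ clusterMarkings T₂ π,
    a₁ ^ count p12 π * a₂ ^ count p21 π

/-- The involutory cluster generating function `CI(x, t, u₁, u₂, v₁, v₂)` for `T = {12, 21}`. -/
noncomputable def involutoryClusterGF (t u₁ u₂ v₁ v₂ : R) : R⟦X⟧ :=
  PowerSeries.mk fun n => ∑ π ∈ involutions n, ∑ _M ∈ clusterMarkings T₂ π,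
    weight t u₁ u₂ v₁ v₂ π

/-- The generating function `F(x, t, u₁, u₂, v₁, v₂)` of involutions for `T = {12, 21}`. -/
noncomputable def involutionGF (t u₁ u₂ v₁ v₂ : R) : R⟦X⟧ :=
  PowerSeries.mk fun n => ∑ π ∈ involutions n, weight t u₁ u₂ v₁ v₂ π

/-! ### Fractions and continued fractions of power series -/

/-- The fraction `f / g` of formal power series, for invertible `g`. -/
noncomputable def frac (f g : R⟦X⟧) : R⟦X⟧ := f * Ring.inverse g

/-- The finite continued fraction
`1 / (1 - A - jB / (1 - A - (j+1)B / ( ⋯ / (1 - A - (j+m-1)B / (1 - A)))))`. -/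
noncomputable def convergent (A B : R⟦X⟧) : ℕ → ℕ → R⟦X⟧
  | _, 0 => frac 1 (1 - A)
  | j, m + 1 => frac 1 (1 - A - (j : R⟦X⟧) * B * convergent A B (j + 1) m)

/-- `F = 1 / (1 - A - B / (1 - A - 2B / (1 - A - 3B / ⋯)))` as a formal continued fraction:
`A` and `B` have no constant term (so that all denominators are invertible), and every coefficient
of the `m`-th convergent is equal to that of `F` for all large `m`. -/
def IsContinuedFraction (F A B : R⟦X⟧) : Prop :=
  constantCoeff A = 0 ∧ constantCoeff B = 0 ∧
    ∀ n : ℕ, ∀ᶠ m in Filter.atTop, coeff n (convergent A B 1 m) = coeff n F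

/-- `A = xt + x²t²(u₁-1)/(1-xt(u₁-1)) + (u₂-1+xt(v₂²-1))x²/(1-x²(v₂²-1))`. -/
noncomputable def serA (t u₁ u₂ v₂ : R) : R⟦X⟧ :=
  X * C t + frac (X ^ 2 * C t ^ 2 * (C u₁ - 1)) (1 - X * C t * (C u₁ - 1)) +
    frac ((C u₂ - 1 + X * C t * (C v₂ ^ 2 - 1)) * X ^ 2) (1 - X ^ 2 * (C v₂ ^ 2 - 1))

/-- `B = x² + x⁴(v₁²-1)/(1-x²(v₁²-1)) + (v₂²-1+x²(v₂²-1)²)x⁴/(1-x⁴(v₂²-1)²)`. -/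
noncomputable def serB (v₁ v₂ : R) : R⟦X⟧ :=
  X ^ 2 + frac (X ^ 4 * (C v₁ ^ 2 - 1)) (1 - X ^ 2 * (C v₁ ^ 2 - 1)) +
    frac ((C v₂ ^ 2 - 1 + X ^ 2 * (C v₂ ^ 2 - 1) ^ 2) * X ^ 4) (1 - X ^ 4 * (C v₂ ^ 2 - 1) ^ 2)

end GeneratingFunctions

/-! ### The families counted by the specializations -/

/-- Two consecutive entries of `π` never differ by one. -/
def IsHertzsprungAvoiding {n : ℕ} (π : Perm (Fin n)) : Prop :=
  ∀ i j : Fin n, (j : ℕ) = i + 1 → |((π j : ℕ) : ℤ) - ((π i : ℕ) : ℤ)| ≠ 1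

/-- `π` is irreducible: `π(i+1) - π(i) ≠ 1` for every `i`. -/
def IsIrreducible {n : ℕ} (π : Perm (Fin n)) : Prop :=
  ∀ i j : Fin n, (j : ℕ) = i + 1 → ((π j : ℕ) : ℤ) - ((π i : ℕ) : ℤ) ≠ 1

/-- Perfect matchings of `{1, …, n}`, as involutions without fixed points
(`i` is matched with `π i`). -/
def perfectMatchings (n : ℕ) : Finset (Perm (Fin n)) :=
  (involutions n).filter fun π => ∀ i, π i ≠ i

/-- The number of short pairs of a matching: arcs that connect two consecutive elements
`i` and `i + 1`. -/
def shortPairs {n : ℕ} (π : Perm (Fin n)) : ℕ :=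
  (univ.filter fun i : Fin n => (π i : ℕ) = i + 1).card

end Hertzsprung

open Hertzsprung

/-!
# Involutions by occurrences of `12` and `21`: clusters and a continued fraction

A marked permutation is a cluster exactly when every place between two adjacent letters is straddled
by a marked occurrence. Then consecutive entries differ by one, and injectivity forces a constant
slope (`natFun_slope`), so the permutation is the identity or the reversal and everything is marked
(`isCluster_iff`).

The generating function of involutions is computed by the cluster method. In an involution, the
occurrences of `12` and `21` are permuted by the sibling map. Hence the weight is a product over
pairs of siblings (`weight_eq_prod`), and writing every factor `w` as `1 + (w - 1)` turns it into a
sum over the sets of adjacencies closed under siblings (`weight_eq_sum`). Such a set of "glued"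
adjacencies is the same as a composition of `n`, whose blocks are the runs of glued positions. An
involution is compatible with a composition exactly when it maps every block monotonically to a
block of the same size (`exists_isBlockInvolution`), that is, when it is the inflation of an
involution `σ` of the blocks together with a direction for each orbit of `σ`
(`sum_compatible_eq_blockSum`). A block that is mapped to itself contributes to the series `A`, a
pair of exchanged blocks contributes to `B`, and so
`F = ∑ₘ ∑_σ A ^ (fixed points of σ) * B ^ (2-cycles of σ)`, where `σ` runs over the involutions of
`m` points (`coeff_involutionGF`, `sum_blockSum_eq_coeff`).

The inner sums satisfy `Iₘ₊₂ = A Iₘ₊₁ + (m + 1) B Iₘ` (`sum_involutions_eq`). For the continued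
fraction, let `Hₖ = ∑ₘ (m choose k) Bᵏ Iₘ₋ₖ` count involutions with `k` half-open arcs. The recurrence
becomes the tridiagonal system `(1 - A) Hₖ = [k = 0] + B Hₖ₋₁ + (k + 1) Hₖ₊₁`. As `Hₖ` is divisible by
`Xᵏ`, backward elimination starting at a large index expresses `H₀ = F` by the convergents up to a
high power of `X` (`X_pow_dvd_sub_convergent`, `isContinuedFraction_of_coeff`).
-/

namespace Hertzsprung

/-! ### Fractions of power series and the continued fraction -/

section ContinuedFraction

variable {R : Type*} [CommRing R]

theorem isUnit_of_constantCoeff_eq_one {g : R⟦X⟧} (hg : constantCoeff g = 1) : IsUnit g := by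
  rw [isUnit_iff_constantCoeff, hg]
  exact isUnit_one

theorem frac_mul_cancel {f g : R⟦X⟧} (hg : constantCoeff g = 1) : frac f g * g = f := by
  rw [frac, Ring.inverse_mul_cancel_right _ _ (isUnit_of_constantCoeff_eq_one hg)]

theorem eq_frac_of_mul_eq {f g h : R⟦X⟧} (hg : constantCoeff g = 1) (H : h * g = f) :
    h = frac f g :=
  (Ring.eq_mul_inverse_iff_mul_eq _ _ _ (isUnit_of_constantCoeff_eq_one hg)).2 H

theorem frac_mul_mul_right {f g h : R⟦X⟧} (hg : constantCoeff g = 1) (hh : constantCoeff h = 1) :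
    frac (f * h) (g * h) = frac f g := by
  refine (eq_frac_of_mul_eq (by simp [hg, hh]) ?_).symm
  rw [← mul_assoc, frac_mul_cancel hg]

/-- The weighted number of involutions of `m` points, where a fixed point has weight `A` and a
`2`-cycle has weight `B`, given by its three-term recurrence (look at the image of one point). -/
noncomputable def involutionPoly {S : Type*} [CommRing S] (A B : S) : ℕ → S
  | 0 => 1
  | 1 => A
  | m + 2 => A * involutionPoly A B (m + 1) + ((m + 1 : ℕ) : S) * B * involutionPoly A B m

/-- The weighted number of partial involutions of `m` points with `k` half-open arcs, each of
weight `B`: the generating function of Motzkin paths that end at height `k`. -/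
noncomputable def openInvolutionPoly (A B : R⟦X⟧) (m k : ℕ) : R⟦X⟧ :=
  (m.choose k : R⟦X⟧) * B ^ k * involutionPoly A B (m - k)

theorem involutionPoly_succ {S : Type*} [CommRing S] (A B : S) (m : ℕ) :
    involutionPoly A B (m + 1) =
      A * involutionPoly A B m + (m : S) * B * involutionPoly A B (m - 1) := by
  cases m with
  | zero => simp [involutionPoly]
  | succ m => simp [involutionPoly]

theorem choose_mul_involutionPoly (A B : R⟦X⟧) (m k : ℕ) :
    (m.choose k : R⟦X⟧) * involutionPoly A B (m + 1 - k) =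
      A * ((m.choose k : R⟦X⟧) * involutionPoly A B (m - k)) +
        ((k + 1 : ℕ) : R⟦X⟧) * ((m.choose (k + 1) : R⟦X⟧) *
          (B * involutionPoly A B (m - (k + 1)))) := by
  rcases lt_or_ge m k with h | h
  · simp [Nat.choose_eq_zero_of_lt h, Nat.choose_eq_zero_of_lt (h.trans (Nat.lt_succ_self k))]
  · have h1 : m + 1 - k = (m - k) + 1 := by omega
    have h2 : (((k + 1 : ℕ) : R⟦X⟧)) * (m.choose (k + 1) : R⟦X⟧) =
        ((m - k : ℕ) : R⟦X⟧) * (m.choose k : R⟦X⟧) := by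
      have := Nat.choose_succ_right_eq m k
      rw [← Nat.cast_mul, ← Nat.cast_mul, mul_comm (k + 1), this, mul_comm]
    rw [h1, involutionPoly_succ, ← mul_assoc _ (m.choose (k + 1) : R⟦X⟧), h2,
      show m - k - 1 = m - (k + 1) by omega]
    ring

theorem openInvolutionPoly_succ_zero (A B : R⟦X⟧) (m : ℕ) :
    openInvolutionPoly A B (m + 1) 0 =
      A * openInvolutionPoly A B m 0 + openInvolutionPoly A B m 1 := by
  have := choose_mul_involutionPoly A B m 0
  simp only [openInvolutionPoly, Nat.choose_zero_right, pow_zero, pow_one] at this ⊢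
  simp only [Nat.cast_one, one_mul, zero_add, Nat.sub_zero, mul_one] at this ⊢
  rw [this]; ring

theorem openInvolutionPoly_succ_succ (A B : R⟦X⟧) (m k : ℕ) :
    openInvolutionPoly A B (m + 1) (k + 1) =
      A * openInvolutionPoly A B m (k + 1) + B * openInvolutionPoly A B m k +
        ((k + 2 : ℕ) : R⟦X⟧) * openInvolutionPoly A B m (k + 2) := by
  have := choose_mul_involutionPoly A B m (k + 1)
  simp only [openInvolutionPoly, Nat.choose_succ_succ m k, Nat.cast_add (m.choose k), add_mul]
  rw [mul_right_comm ((m.choose (k + 1) : ℕ) : R⟦X⟧), this, Nat.add_sub_add_right]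
  ring

theorem X_pow_dvd_involutionPoly {A B : R⟦X⟧} (hA : X ∣ A) (hB : X ^ 2 ∣ B) (m : ℕ) :
    X ^ m ∣ involutionPoly A B m := by
  induction m using Nat.twoStepInduction with
  | zero => simp
  | one => simpa [involutionPoly] using hA
  | more m h1 h2 =>
    rw [involutionPoly]
    refine dvd_add ?_ ?_
    · rw [pow_succ' _ (m + 1)]
      exact mul_dvd_mul hA h2
    · rw [mul_assoc, pow_add, mul_comm (X ^ m)]
      exact (mul_dvd_mul hB h1).mul_left _

theorem X_pow_dvd_openInvolutionPoly {A B : R⟦X⟧} (hA : X ∣ A) (hB : X ^ 2 ∣ B) (m k : ℕ) :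
    X ^ (m + k) ∣ openInvolutionPoly A B m k := by
  rcases lt_or_ge m k with h | h
  · simp [openInvolutionPoly, Nat.choose_eq_zero_of_lt h]
  · rw [openInvolutionPoly, show m + k = 2 * k + (m - k) by omega, pow_add, pow_mul, mul_assoc]
    exact (mul_dvd_mul (pow_dvd_pow_of_dvd hB k) (X_pow_dvd_involutionPoly hA hB _)).mul_left _

/-- The truncated generating function `∑_{m ≤ N}` of the partial involutions with `k` open arcs. -/
noncomputable def openInvolutionSum (A B : R⟦X⟧) (N k : ℕ) : R⟦X⟧ :=
  ∑ m ∈ range (N + 1), openInvolutionPoly A B m k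

theorem X_pow_dvd_openInvolutionSum {A B : R⟦X⟧} (hA : X ∣ A) (hB : X ^ 2 ∣ B) (N k : ℕ) :
    X ^ k ∣ openInvolutionSum A B N k :=
  dvd_sum fun m _ =>
    (pow_dvd_pow X (Nat.le_add_left k m)).trans (X_pow_dvd_openInvolutionPoly hA hB m k)

theorem openInvolutionSum_eq_sub (A B : R⟦X⟧) (N k : ℕ) :
    ∑ m ∈ range N, openInvolutionPoly A B m k =
      openInvolutionSum A B N k - openInvolutionPoly A B N k := by
  rw [openInvolutionSum, sum_range_succ]; ring

theorem X_pow_dvd_tridiagonal_zero {A B : R⟦X⟧} (hA : X ∣ A) (hB : X ^ 2 ∣ B) (N : ℕ) :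
    X ^ N ∣ (1 - A) * openInvolutionSum A B N 0 - 1 - openInvolutionSum A B N 1 := by
  have h : openInvolutionSum A B N 0 = A * (openInvolutionSum A B N 0 -
      openInvolutionPoly A B N 0) + (openInvolutionSum A B N 1 - openInvolutionPoly A B N 1) + 1 := by
    conv_lhs => rw [openInvolutionSum, sum_range_succ']
    rw [← openInvolutionSum_eq_sub, ← openInvolutionSum_eq_sub, mul_sum, ← sum_add_distrib]
    congr 1
    · exact sum_congr rfl fun m _ => openInvolutionPoly_succ_zero A B m
    · simp [openInvolutionPoly, involutionPoly]
  have h' : (1 - A) * openInvolutionSum A B N 0 - 1 - openInvolutionSum A B N 1 =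
      -(A * openInvolutionPoly A B N 0 + openInvolutionPoly A B N 1) := by
    linear_combination h
  rw [h', dvd_neg]
  exact dvd_add ((X_pow_dvd_openInvolutionPoly hA hB N 0).mul_left _)
    ((pow_dvd_pow X (Nat.le_succ N)).trans (X_pow_dvd_openInvolutionPoly hA hB N 1))

theorem X_pow_dvd_tridiagonal_succ {A B : R⟦X⟧} (hA : X ∣ A) (hB : X ^ 2 ∣ B) (N k : ℕ) :
    X ^ N ∣ (1 - A) * openInvolutionSum A B N (k + 1) - B * openInvolutionSum A B N k -
      ((k + 2 : ℕ) : R⟦X⟧) * openInvolutionSum A B N (k + 2) := by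
  have h : openInvolutionSum A B N (k + 1) = A * (openInvolutionSum A B N (k + 1) -
      openInvolutionPoly A B N (k + 1)) + B * (openInvolutionSum A B N k -
        openInvolutionPoly A B N k) + ((k + 2 : ℕ) : R⟦X⟧) * (openInvolutionSum A B N (k + 2) -
          openInvolutionPoly A B N (k + 2)) := by
    conv_lhs => rw [openInvolutionSum, sum_range_succ']
    rw [← openInvolutionSum_eq_sub, ← openInvolutionSum_eq_sub, ← openInvolutionSum_eq_sub,
      mul_sum, mul_sum, mul_sum, ← sum_add_distrib, ← sum_add_distrib]
    have h0 : openInvolutionPoly A B 0 (k + 1) = 0 := by simp [openInvolutionPoly]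
    rw [h0, add_zero]
    exact sum_congr rfl fun m _ => openInvolutionPoly_succ_succ A B m k
  have h' : (1 - A) * openInvolutionSum A B N (k + 1) - B * openInvolutionSum A B N k -
      ((k + 2 : ℕ) : R⟦X⟧) * openInvolutionSum A B N (k + 2) =
      -(A * openInvolutionPoly A B N (k + 1) + B * openInvolutionPoly A B N k +
        ((k + 2 : ℕ) : R⟦X⟧) * openInvolutionPoly A B N (k + 2)) := by
    linear_combination h
  have hd : ∀ l, X ^ N ∣ openInvolutionPoly A B N l := fun l =>
    (pow_dvd_pow X (Nat.le_add_right N l)).trans (X_pow_dvd_openInvolutionPoly hA hB N l)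
  rw [h', dvd_neg]
  exact dvd_add (dvd_add ((hd _).mul_left _) ((hd _).mul_left _)) ((hd _).mul_left _)

theorem constantCoeff_denominator {A B : R⟦X⟧} (hA : constantCoeff A = 0)
    (hB : constantCoeff B = 0) (j : ℕ) (f : R⟦X⟧) :
    constantCoeff (1 - A - (j : R⟦X⟧) * B * f) = 1 := by
  simp [hA, hB]

/-- The convergents of the continued fraction solve the tridiagonal system approximately: this is
backward elimination, started with an unknown that vanishes to high order. -/
theorem X_pow_dvd_sub_convergent {A B : R⟦X⟧} (hA : X ∣ A) (hB : X ^ 2 ∣ B) (N m k j : ℕ)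
    (hjN : j ≤ N) (hj : j ≤ m + k + 2) :
    X ^ j ∣ openInvolutionSum A B N (k + 1) -
      convergent A B (k + 2) m * B * openInvolutionSum A B N k := by
  have hA0 : constantCoeff A = 0 := X_dvd_iff.1 hA
  have hB0 : constantCoeff B = 0 := X_dvd_iff.1 ((dvd_pow_self X two_ne_zero).trans hB)
  induction m generalizing k with
  | zero =>
    have hu : constantCoeff (1 - A) = 1 := by simp [hA0]
    have hK : convergent A B (k + 2) 0 * (1 - A) = 1 := by
      rw [convergent]; exact frac_mul_cancel hu
    rw [← (isUnit_of_constantCoeff_eq_one hu).dvd_mul_left]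
    have h1 := (pow_dvd_pow X hjN).trans (X_pow_dvd_tridiagonal_succ hA hB N k)
    have h2 := (pow_dvd_pow X (by omega : j ≤ k + 2)).trans
      (X_pow_dvd_openInvolutionSum hA hB N (k + 2))
    convert dvd_add h1 (h2.mul_left ((k + 2 : ℕ) : R⟦X⟧)) using 1
    linear_combination (-B * openInvolutionSum A B N k) * hK
  | succ m ih =>
    have hu := constantCoeff_denominator hA0 hB0 (k + 2) (convergent A B (k + 3) m)
    have hK : convergent A B (k + 2) (m + 1) *
        (1 - A - ((k + 2 : ℕ) : R⟦X⟧) * B * convergent A B (k + 3) m) = 1 := by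
      rw [convergent]; exact frac_mul_cancel hu
    rw [← (isUnit_of_constantCoeff_eq_one hu).dvd_mul_left]
    have h1 := (pow_dvd_pow X hjN).trans (X_pow_dvd_tridiagonal_succ hA hB N k)
    have h2 := ih (k + 1) (by omega)
    convert dvd_add h1 (h2.mul_left ((k + 2 : ℕ) : R⟦X⟧)) using 1
    linear_combination (-B * openInvolutionSum A B N k) * hK

/-- The generating function of all involutions weighted by `A` and `B` is the continued
fraction with partial numerators `B, 2B, 3B, …`. -/
theorem isContinuedFraction_of_coeff {F A B : R⟦X⟧} (hA : X ∣ A) (hB : X ^ 2 ∣ B)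
    (hF : ∀ n, coeff n F = ∑ m ∈ range (n + 1), coeff n (involutionPoly A B m)) :
    IsContinuedFraction F A B := by
  have hA0 : constantCoeff A = 0 := X_dvd_iff.1 hA
  have hB0 : constantCoeff B = 0 := X_dvd_iff.1 ((dvd_pow_self X two_ne_zero).trans hB)
  refine ⟨hA0, hB0, fun n => Filter.eventually_atTop.2 ⟨n + 1, fun m hm => ?_⟩⟩
  obtain ⟨m, rfl⟩ : ∃ l, m = l + 1 := ⟨m - 1, by omega⟩
  have hu := constantCoeff_denominator hA0 hB0 1 (convergent A B 2 m)
  have hK : convergent A B 1 (m + 1) *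
      (1 - A - ((1 : ℕ) : R⟦X⟧) * B * convergent A B 2 m) = 1 := by
    rw [convergent]; exact frac_mul_cancel hu
  have key : X ^ (n + 1) ∣ openInvolutionSum A B (n + 1) 0 - convergent A B 1 (m + 1) := by
    rw [← (isUnit_of_constantCoeff_eq_one hu).dvd_mul_left]
    have h1 := X_pow_dvd_tridiagonal_zero hA hB (n + 1)
    have h2 := X_pow_dvd_sub_convergent hA hB (n + 1) m 0 (n + 1) le_rfl (by omega)
    convert dvd_add h1 h2 using 1
    push_cast at hK ⊢
    linear_combination - hK
  have h0 := X_pow_dvd_iff.1 key n (Nat.lt_succ_self n)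
  have h1 : coeff n (openInvolutionPoly A B (n + 1) 0) = 0 :=
    X_pow_dvd_iff.1 (X_pow_dvd_openInvolutionPoly hA hB (n + 1) 0) n (by omega)
  rw [map_sub, sub_eq_zero, openInvolutionSum, sum_range_succ, map_add, h1, add_zero,
    map_sum] at h0
  rw [← h0, hF]
  exact sum_congr rfl fun m _ => by simp [openInvolutionPoly]

theorem serB_eq (v₁ v₂ : R) : serB v₁ v₂ =
      X ^ 2 + frac (X ^ 4 * (C v₁ ^ 2 - 1)) (1 - X ^ 2 * (C v₁ ^ 2 - 1)) +
        frac (X ^ 4 * (C v₂ ^ 2 - 1)) (1 - X ^ 2 * (C v₂ ^ 2 - 1)) := by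
  rw [serB]
  congr 1
  rw [← frac_mul_mul_right (f := X ^ 4 * (C v₂ ^ 2 - 1)) (g := 1 - X ^ 2 * (C v₂ ^ 2 - 1))
    (h := 1 + X ^ 2 * (C v₂ ^ 2 - 1)) (by simp) (by simp)]
  congr 1 <;> ring

end ContinuedFraction

/-! ### Counting involutions by fixed points and two-cycles -/

theorem mem_involutions {n : ℕ} {π : Perm (Fin n)} :
    π ∈ involutions n ↔ ∀ i, π (π i) = i := by
  rw [involutions, mem_filter, and_iff_right (mem_univ _), _root_.inv_eq_iff_mul_eq_one]
  simp [Equiv.ext_iff]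

/-- The number of `2`-cycles of an involution: a `2`-cycle is represented by its least element. -/
def twoCycles {n : ℕ} (σ : Perm (Fin n)) : ℕ :=
  (univ.filter fun a => a < σ a).card

theorem card_filter_gt {n : ℕ} {σ : Perm (Fin n)} (hσ : σ ∈ involutions n) :
    (univ.filter fun a => σ a < a).card = twoCycles σ := by
  rw [mem_involutions] at hσ
  refine card_bij (fun a _ => σ a) ?_ (fun a _ b _ h => σ.injective h) ?_
  · intro a ha
    simpa [hσ a] using ha
  · intro a ha
    exact ⟨σ a, by simpa [hσ a] using ha, hσ a⟩

theorem fp_add_two_mul_twoCycles {n : ℕ} {σ : Perm (Fin n)} (hσ : σ ∈ involutions n) :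
    fp σ + 2 * twoCycles σ = n := by
  have h1 : (univ.filter fun a => σ a = a).card + (univ.filter fun a => ¬ σ a = a).card = n := by
    rw [card_filter_add_card_filter_not, card_univ, Fintype.card_fin]
  have h2 : (univ.filter fun a => ¬ σ a = a) =
      (univ.filter fun a => a < σ a) ∪ (univ.filter fun a => σ a < a) := by
    ext a
    simp only [mem_filter, mem_univ, true_and, mem_union]
    rw [← ne_eq, ne_iff_lt_or_gt, or_comm]
  have h3 : Disjoint (univ.filter fun a => a < σ a) (univ.filter fun a => σ a < a) := by
    rw [disjoint_filter]
    intro a _ h h'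
    exact absurd h (not_lt.2 h'.le)
  rw [h2, card_union_of_disjoint h3, card_filter_gt hσ] at h1
  rw [fp]
  unfold twoCycles at h1 ⊢
  omega

theorem mem_involutions_and_twoCycles_iff {n p : ℕ} {σ : Perm (Fin n)} :
    σ ∈ involutions n ∧ twoCycles σ = p ↔ σ.cycleType = Multiset.replicate p 2 := by
  constructor
  · rintro ⟨hσ, rfl⟩
    have h2 : σ ^ 2 = 1 := by
      ext i
      simp [pow_two, mem_involutions.1 hσ i]
    have : Fact (Nat.Prime 2) := ⟨Nat.prime_two⟩
    have h3 := Equiv.Perm.cycleType_of_pow_prime_eq_one h2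
    have h4 := σ.sum_cycleType
    rw [h3, Multiset.sum_replicate, smul_eq_mul] at h4
    have h5 : fp σ + σ.support.card = n := by
      rw [fp, Equiv.Perm.support, card_filter_add_card_filter_not, card_univ, Fintype.card_fin]
    have h6 := fp_add_two_mul_twoCycles hσ
    rw [h3]
    congr 1
    omega
  · intro h
    have h2 : σ ^ 2 = 1 := by
      rw [← orderOf_dvd_iff_pow_eq_one, ← Equiv.Perm.lcm_cycleType, h, Multiset.lcm_dvd]
      intro b hb
      rw [Multiset.eq_of_mem_replicate hb]
    have hσ : σ ∈ involutions n := by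
      rw [mem_involutions]
      intro i
      have := Equiv.ext_iff.1 h2 i
      simpa [pow_two] using this
    refine ⟨hσ, ?_⟩
    have h4 := σ.sum_cycleType
    rw [h, Multiset.sum_replicate, smul_eq_mul] at h4
    have h5 : fp σ + σ.support.card = n := by
      rw [fp, Equiv.Perm.support, card_filter_add_card_filter_not, card_univ, Fintype.card_fin]
    have h6 := fp_add_two_mul_twoCycles hσ
    omega

/-- The number of involutions of `n` points with `p` two-cycles. -/
def involutionNumber (n p : ℕ) : ℕ :=
  ((involutions n).filter fun σ => twoCycles σ = p).card

theorem involutionNumber_eq (n p : ℕ) :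
    involutionNumber n p =
      (univ.filter fun σ : Perm (Fin n) => σ.cycleType = Multiset.replicate p 2).card := by
  rw [involutionNumber]
  congr 1
  ext σ
  rw [mem_filter, mem_involutions_and_twoCycles_iff]
  simp

theorem involutionNumber_mul {n p : ℕ} (h : 2 * p ≤ n) :
    involutionNumber n p * ((n - 2 * p).factorial * 2 ^ p * p.factorial) = n.factorial := by
  have := Equiv.Perm.card_of_cycleType_mul_eq (Fin n) (Multiset.replicate p 2)
  rw [if_pos (by
    refine ⟨by simp; omega, fun a ha => (Multiset.eq_of_mem_replicate ha).ge⟩)] at this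
  rw [involutionNumber_eq]
  simp only [Fintype.card_fin, Multiset.sum_replicate, smul_eq_mul, Multiset.prod_replicate]
    at this
  rw [← this, mul_comm p 2]
  congr 2
  rcases Nat.eq_zero_or_pos p with rfl | hp
  · simp
  · rw [Multiset.toFinset_replicate, if_neg (by omega)]
    simp

theorem involutionNumber_eq_zero {n p : ℕ} (h : n < 2 * p) : involutionNumber n p = 0 := by
  rw [involutionNumber, card_eq_zero, filter_eq_empty_iff]
  intro σ hσ h'
  have := fp_add_two_mul_twoCycles hσ
  omega

theorem involutionNumber_zero (n : ℕ) : involutionNumber n 0 = 1 := by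
  have := involutionNumber_mul (n := n) (p := 0) (by omega)
  simpa [Nat.factorial_ne_zero] using this

theorem involutionNumber_succ_succ (n p : ℕ) :
    involutionNumber (n + 2) (p + 1) =
      involutionNumber (n + 1) (p + 1) + (n + 1) * involutionNumber n p := by
  rcases lt_or_ge n (2 * p) with h | h
  · rw [involutionNumber_eq_zero (by omega), involutionNumber_eq_zero (by omega),
      involutionNumber_eq_zero h]
    simp
  have e1 := involutionNumber_mul (n := n + 2) (p := p + 1) (by omega)
  have e2 := involutionNumber_mul (n := n) (p := p) h
  rw [show n + 2 - 2 * (p + 1) = n - 2 * p by omega] at e1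
  have hpos : 0 < (n - 2 * p).factorial * 2 ^ (p + 1) * (p + 1).factorial := by positivity
  refine Nat.eq_of_mul_eq_mul_right hpos ?_
  rw [e1]
  rw [pow_succ, Nat.factorial_succ p]
  rcases Nat.eq_or_lt_of_le h with h0 | h0
  · rw [involutionNumber_eq_zero (by omega : n + 1 < 2 * (p + 1)), zero_add,
      Nat.factorial_succ, Nat.factorial_succ, ← e2, h0]
    rw [show n + 1 + 1 = 2 * (p + 1) by omega]
    ring
  · have e3 := involutionNumber_mul (n := n + 1) (p := p + 1) (by omega)
    obtain ⟨d, hd⟩ : ∃ d, n = 2 * p + d + 1 := ⟨n - 2 * p - 1, by omega⟩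
    rw [show n + 1 - 2 * (p + 1) = d by omega, pow_succ, Nat.factorial_succ p] at e3
    rw [show n - 2 * p = d + 1 by omega, Nat.factorial_succ d] at e2 ⊢
    have e4 : (n + 2).factorial = (n + 2) * (n + 1).factorial := Nat.factorial_succ _
    have e5 : (n + 1).factorial = (n + 1) * n.factorial := Nat.factorial_succ _
    have e6 : (n + 2).factorial = (d + 1) * (n + 1).factorial +
        2 * (p + 1) * ((n + 1) * n.factorial) := by
      rw [e4, ← e5, ← add_mul]; congr 1; omega
    rw [e6, ← e3, ← e2]
    ring

/-- Summing over all involutions gives the polynomials that satisfy the three-term recurrence. -/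
theorem sum_involutions_eq {S : Type*} [CommRing S] (A B : S) (m : ℕ) :
    ∑ σ ∈ involutions m, A ^ fp σ * B ^ twoCycles σ = involutionPoly A B m := by
  have key : ∀ m P, m ≤ 2 * P + 1 → ∑ σ ∈ involutions m, A ^ fp σ * B ^ twoCycles σ =
      ∑ p ∈ range (P + 1), (involutionNumber m p : S) * (A ^ (m - 2 * p) * B ^ p) := by
    intro m P hP
    rw [← sum_fiberwise_of_maps_to (g := twoCycles) (t := range (P + 1))]
    · refine sum_congr rfl fun p _ => ?_
      rw [involutionNumber, ← nsmul_eq_mul]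
      refine sum_eq_card_nsmul fun σ hσ => ?_
      rw [mem_filter] at hσ
      have := fp_add_two_mul_twoCycles hσ.1
      rw [hσ.2] at this ⊢
      rw [show fp σ = m - 2 * p by omega]
    · intro σ hσ
      have := fp_add_two_mul_twoCycles hσ
      rw [mem_range]; omega
  induction m using Nat.twoStepInduction with
  | zero => rw [key 0 0 (by omega)]; simp [involutionPoly, involutionNumber_zero]
  | one => rw [key 1 0 (by omega)]; simp [involutionPoly, involutionNumber_zero]
  | more m h1 h2 =>
    rw [involutionPoly, ← h1, ← h2, key m m (by omega), key (m + 1) (m + 1) (by omega),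
      key (m + 2) (m + 1) (by omega), sum_range_succ', sum_range_succ' _ (m + 1), mul_add, mul_sum,
      mul_sum, add_right_comm, ← sum_add_distrib]
    congr 1
    · refine sum_congr rfl fun p _ => ?_
      rw [involutionNumber_succ_succ]
      rcases lt_or_ge m (2 * p + 1) with h | h
      · rw [involutionNumber_eq_zero (by omega : m + 1 < 2 * (p + 1)),
          show m + 2 - 2 * (p + 1) = m - 2 * p by omega]
        push_cast; ring
      · rw [show m + 2 - 2 * (p + 1) = m - 2 * p by omega,
          show m - 2 * p = (m + 1 - 2 * (p + 1)) + 1 by omega]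
        push_cast; ring
    · simp [involutionNumber_zero]; ring

/-! ### Permutations as functions on the natural numbers, and their occurrences -/

/-- A permutation of `Fin n` as a function on `ℕ` that fixes every `i ≥ n`. -/
def natFun {n : ℕ} (π : Perm (Fin n)) (i : ℕ) : ℕ :=
  if h : i < n then (π ⟨i, h⟩ : ℕ) else i

section NatFun

variable {n : ℕ} (π : Perm (Fin n))

theorem natFun_of_lt {i : ℕ} (h : i < n) : natFun π i = π ⟨i, h⟩ := dif_pos h

@[simp] theorem natFun_val (i : Fin n) : natFun π i = π i := natFun_of_lt π i.2

theorem natFun_lt {i : ℕ} (h : i < n) : natFun π i < n := by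
  rw [natFun_of_lt π h]; exact Fin.is_lt _

theorem natFun_inj {i j : ℕ} (hi : i < n) (hj : j < n) (h : natFun π i = natFun π j) : i = j := by
  rw [natFun_of_lt π hi, natFun_of_lt π hj] at h
  simpa using π.injective (Fin.ext h)

variable {π}

theorem ext_natFun {π' : Perm (Fin n)} (h : ∀ i < n, natFun π i = natFun π' i) : π = π' := by
  ext i
  simpa using h i i.2

theorem natFun_natFun (hπ : π ∈ involutions n) {i : ℕ} (hi : i < n) :
    natFun π (natFun π i) = i := by
  rw [natFun_of_lt π hi, natFun_val, mem_involutions.1 hπ]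

theorem natFun_one {i : ℕ} : natFun (1 : Perm (Fin n)) i = i := by
  unfold natFun; split_ifs <;> simp

theorem natFun_revPerm {i : ℕ} (h : i < n) : natFun (Fin.revPerm : Perm (Fin n)) i = n - 1 - i := by
  rw [natFun_of_lt _ h, Fin.revPerm_apply, Fin.val_rev]
  simp only; omega

variable (π)

theorem oneLine_getElem? (i a : ℕ) :
    (oneLine π)[i]? = some a ↔ i < n ∧ natFun π i + 1 = a := by
  rw [oneLine, List.getElem?_ofFn]
  split_ifs with h
  · simp [natFun_of_lt π h, h]
  · simp [h]

end NatFun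

/-- The bounds on positions and letters in the definition of `occ` are implied by the occurrence
itself, provided that the pattern is non-empty. -/
theorem mem_occ {k : ℕ} {τ : Perm (Fin k)} (i₀ : Fin k) {w : List ℕ} {p : ℕ × ℕ} :
    p ∈ occ τ w ↔ ∀ i : Fin k, w[p.1 + (i : ℕ)]? = some (((τ i : ℕ) + 1) + p.2) := by
  rw [occ, mem_filter, and_iff_right_iff_imp]
  intro h
  obtain ⟨h1, h2⟩ := List.getElem?_eq_some_iff.1 (h i₀)
  have h3 := List.single_le_sum (l := w) (by simp) _ (List.getElem_mem h1)
  rw [mem_product, mem_range, mem_range]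
  omega

theorem mem_occ_p12 {w : List ℕ} {p : ℕ × ℕ} :
    p ∈ occ p12 w ↔ w[p.1]? = some (p.2 + 1) ∧ w[p.1 + 1]? = some (p.2 + 2) := by
  rw [mem_occ 0, Fin.forall_fin_two]
  simp [p12, add_comm]

theorem mem_occ_p21 {w : List ℕ} {p : ℕ × ℕ} :
    p ∈ occ p21 w ↔ w[p.1]? = some (p.2 + 2) ∧ w[p.1 + 1]? = some (p.2 + 1) := by
  rw [mem_occ 0, Fin.forall_fin_two]
  simp [p21, add_comm]

theorem mem_occs {w : List ℕ} {p : ℕ × ℕ} : p ∈ occs T₂ w ↔ p ∈ occ p12 w ∨ p ∈ occ p21 w := by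
  simp [occs, T₂]

theorem mem_occ_p12_oneLine {n : ℕ} {π : Perm (Fin n)} {p : ℕ × ℕ} :
    p ∈ occ p12 (oneLine π) ↔
      p.1 + 1 < n ∧ natFun π p.1 = p.2 ∧ natFun π (p.1 + 1) = p.2 + 1 := by
  rw [mem_occ_p12, oneLine_getElem?, oneLine_getElem?]
  omega

theorem mem_occ_p21_oneLine {n : ℕ} {π : Perm (Fin n)} {p : ℕ × ℕ} :
    p ∈ occ p21 (oneLine π) ↔
      p.1 + 1 < n ∧ natFun π p.1 = p.2 + 1 ∧ natFun π (p.1 + 1) = p.2 := by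
  rw [mem_occ_p21, oneLine_getElem?, oneLine_getElem?]
  omega

/-! ### Clusters -/

theorem lt_length_of_mem_occs {w : List ℕ} {p : ℕ × ℕ} (h : p ∈ occs T₂ w) :
    p.1 + 1 < w.length := by
  rw [mem_occs, mem_occ_p12, mem_occ_p21] at h
  rcases h with ⟨-, h⟩ | ⟨-, h⟩ <;> exact (List.getElem?_eq_some_iff.1 h).1

theorem mem_occs_append_left {α β : List ℕ} {p : ℕ × ℕ} (h : p.1 + 1 < α.length) :
    p ∈ occs T₂ (α ++ β) ↔ p ∈ occs T₂ α := by
  rw [mem_occs, mem_occ_p12, mem_occ_p21, mem_occs, mem_occ_p12, mem_occ_p21,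
    List.getElem?_append_left h, List.getElem?_append_left (by omega)]

theorem mem_occs_append_right {α β : List ℕ} {j c : ℕ} :
    (α.length + j, c) ∈ occs T₂ (α ++ β) ↔ (j, c) ∈ occs T₂ β := by
  rw [mem_occs, mem_occ_p12, mem_occ_p21, mem_occs, mem_occ_p12, mem_occ_p21,
    List.getElem?_append_right (by simp), List.getElem?_append_right (by simp; omega)]
  simp [Nat.add_assoc]

/-- A marked word can be cut exactly at the places that no marked occurrence straddles. -/
theorem isConcatenation_iff {w : List ℕ} {M : Finset (ℕ × ℕ)} (h : IsMarkedWord T₂ w M) :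
    IsConcatenation T₂ w M ↔ ∃ l, 0 < l ∧ l < w.length ∧ ∀ p ∈ M, p.1 + 1 ≠ l := by
  obtain ⟨hnd, hpos, hM⟩ := h
  constructor
  · rintro ⟨α, β, M₁, M₂, hα, hβ, h1, h2, rfl, rfl⟩
    refine ⟨α.length, List.length_pos_iff.2 hα, ?_, ?_⟩
    · have := List.length_pos_iff.2 hβ
      rw [List.length_append]; omega
    · intro p hp
      rw [mem_union, mem_image] at hp
      rcases hp with hp | ⟨q, -, rfl⟩
      · exact (lt_length_of_mem_occs (h1.2.2 hp)).ne
      · simp only; omega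
  · rintro ⟨l, hl0, hl, hp⟩
    obtain ⟨α, β, rfl, rfl⟩ : ∃ α β : List ℕ, w = α ++ β ∧ α.length = l :=
      ⟨w.take l, w.drop l, (List.take_append_drop l w).symm, by simp; omega⟩
    have hleft : ∀ p ∈ M, p.1 < α.length → p ∈ occs T₂ α := fun p h h' =>
      (mem_occs_append_left (by have := hp p h; omega)).1 (hM h)
    refine ⟨α, β, M.filter (fun p => p.1 < α.length),
      (M.filter (fun p => α.length ≤ p.1)).image (fun p => (p.1 - α.length, p.2)),
      List.length_pos_iff.1 hl0, ?_, ⟨hnd.of_append_left, ?_, ?_⟩,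
      ⟨hnd.of_append_right, ?_, ?_⟩, rfl, ?_⟩
    · rintro rfl
      simp at hl
    · exact fun a ha => hpos a (List.mem_append_left _ ha)
    · intro p hp'
      rw [mem_filter] at hp'
      exact hleft p hp'.1 hp'.2
    · exact fun a ha => hpos a (List.mem_append_right _ ha)
    · intro q hq
      rw [mem_image] at hq
      obtain ⟨p, hp', rfl⟩ := hq
      rw [mem_filter] at hp'
      rw [← mem_occs_append_right (α := α), Nat.add_sub_cancel' hp'.2]
      exact hM hp'.1
    · ext p
      simp only [mem_union, mem_filter, mem_image]
      constructor
      · intro h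
        rcases lt_or_ge p.1 α.length with h' | h'
        · exact Or.inl ⟨h, h'⟩
        · exact Or.inr ⟨(p.1 - α.length, p.2), ⟨p, ⟨h, h'⟩, rfl⟩, by simp [h']⟩
      · rintro (h | ⟨_, ⟨q, ⟨hq, hq'⟩, rfl⟩, rfl⟩)
        · exact h.1
        · simpa [Nat.add_sub_cancel' hq'] using hq

theorem nodup_oneLine {n : ℕ} (π : Perm (Fin n)) : (oneLine π).Nodup := by
  rw [oneLine, List.nodup_ofFn]
  intro i j h
  exact π.injective (Fin.ext (by simpa using h))

theorem isMarkedWord_oneLine_iff {n : ℕ} {π : Perm (Fin n)} {M : Finset (ℕ × ℕ)} :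
    IsMarkedWord T₂ (oneLine π) M ↔ M ⊆ occs T₂ (oneLine π) := by
  refine ⟨fun h => h.2.2, fun h => ⟨nodup_oneLine π, ?_, h⟩⟩
  intro a ha
  rw [oneLine, List.mem_ofFn] at ha
  obtain ⟨i, rfl⟩ := ha
  omega

theorem isCluster_iff_forall {n : ℕ} {π : Perm (Fin n)} {M : Finset (ℕ × ℕ)} :
    IsCluster T₂ π M ↔
      2 ≤ n ∧ M ⊆ occs T₂ (oneLine π) ∧ ∀ j < n - 1, ∃ c, (j, c) ∈ M := by
  rw [IsCluster, isMarkedWord_oneLine_iff]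
  refine and_congr_right fun hn => and_congr_right fun hM => ?_
  rw [isConcatenation_iff (isMarkedWord_oneLine_iff.2 hM)]
  have hlen : (oneLine π).length = n := by simp [oneLine]
  rw [hlen]
  push Not
  constructor
  · intro h j hj
    obtain ⟨⟨j', c⟩, hp, hj'⟩ := h (j + 1) (by omega) (by omega)
    obtain rfl : j' = j := by simpa using hj'
    exact ⟨c, hp⟩
  · intro h l hl hl'
    obtain ⟨c, hc⟩ := h (l - 1) (by omega)
    exact ⟨_, hc, by simp; omega⟩

/-- A permutation whose consecutive entries all differ by one is monotone of slope `1` or `-1`: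
by injectivity, the slope cannot change. -/
theorem natFun_slope {n : ℕ} {π : Perm (Fin n)} {a b : ℕ} (hb : b ≤ n)
    (h : ∀ i, a ≤ i → i + 1 < b →
      natFun π (i + 1) = natFun π i + 1 ∨ natFun π i = natFun π (i + 1) + 1) :
    (∀ r, a + r < b → natFun π (a + r) = natFun π a + r) ∨
      (∀ r, a + r < b → natFun π (a + r) + r = natFun π a) := by
  by_cases hab : a + 1 < b
  -- a change of slope between `i` and `i + 2` would repeat a value
  · have step : ∀ i, a ≤ i → i + 2 < b → natFun π (i + 2) ≠ natFun π i := fun i _ hi e => by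
      have := natFun_inj π (by omega) (by omega) e
      omega
    rcases h a le_rfl hab with h0 | h0
    · left
      have key : ∀ r, a + r + 1 < b → natFun π (a + r + 1) = natFun π (a + r) + 1 := by
        intro r
        induction r with
        | zero => intro _; exact h0
        | succ r ih =>
          intro hr
          have h1 := ih (by omega)
          have h2 := step (a + r) (by omega) (by omega)
          have h3 := h (a + r + 1) (by omega) (by omega)
          simp only [← add_assoc] at *
          rcases h3 with h3 | h3
          · exact h3
          · exfalso; apply h2; simp only [add_assoc, Nat.reduceAdd] at *; omega
      intro r
      induction r with
      | zero => intro _; rfl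
      | succ r ih => intro hr; have := key r (by omega); have := ih (by omega); grind
    · right
      have key : ∀ r, a + r + 1 < b → natFun π (a + r) = natFun π (a + r + 1) + 1 := by
        intro r
        induction r with
        | zero => intro _; exact h0
        | succ r ih =>
          intro hr
          have h1 := ih (by omega)
          have h2 := step (a + r) (by omega) (by omega)
          have h3 := h (a + r + 1) (by omega) (by omega)
          simp only [← add_assoc] at *
          rcases h3 with h3 | h3
          · exfalso; apply h2; simp only [add_assoc, Nat.reduceAdd] at *; omega
          · exact h3
      intro r
      induction r with
      | zero => intro _; rfl
      | succ r ih => intro hr; have := key r (by omega); have := ih (by omega); grind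
  · left
    intro r hr
    obtain rfl : r = 0 := by omega
    rfl

theorem occ_p12_one (n : ℕ) :
    occ p12 (oneLine (1 : Perm (Fin n))) = (range (n - 1)).image fun j => (j, j) := by
  ext ⟨j, c⟩
  rw [mem_occ_p12_oneLine, natFun_one, natFun_one, mem_image]
  simp only [mem_range, Prod.mk.injEq]
  constructor
  · rintro ⟨h1, h2, -⟩; exact ⟨j, by omega, rfl, h2⟩
  · rintro ⟨i, h1, rfl, rfl⟩; omega

theorem occ_p21_one (n : ℕ) : occ p21 (oneLine (1 : Perm (Fin n))) = ∅ := by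
  refine eq_empty_of_forall_notMem fun p => ?_
  rw [mem_occ_p21_oneLine, natFun_one, natFun_one]
  omega

theorem occ_p21_revPerm (n : ℕ) :
    occ p21 (oneLine (Fin.revPerm : Perm (Fin n))) =
      (range (n - 1)).image fun j => (j, n - 2 - j) := by
  ext ⟨j, c⟩
  rw [mem_occ_p21_oneLine, mem_image]
  simp only [mem_range, Prod.mk.injEq]
  constructor
  · rintro ⟨h1, h2, h3⟩
    rw [natFun_revPerm (by omega)] at h2
    exact ⟨j, by omega, rfl, by omega⟩
  · rintro ⟨i, h1, rfl, rfl⟩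
    rw [natFun_revPerm (by omega), natFun_revPerm (by omega)]
    omega

theorem occ_p12_revPerm (n : ℕ) : occ p12 (oneLine (Fin.revPerm : Perm (Fin n))) = ∅ := by
  refine eq_empty_of_forall_notMem fun p => ?_
  rw [mem_occ_p12_oneLine]
  rintro ⟨h1, h2, h3⟩
  rw [natFun_revPerm (by omega)] at h2 h3
  omega

theorem isCluster_iff (n : ℕ) (π : Perm (Fin n)) (M : Finset (ℕ × ℕ)) : IsCluster T₂ π M ↔
      2 ≤ n ∧ ((π = 1 ∧ M = (range (n - 1)).image fun j => (j, j)) ∨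
        (π = Fin.revPerm ∧ M = (range (n - 1)).image fun j => (j, n - 2 - j))) := by
  rw [isCluster_iff_forall]
  refine and_congr_right fun hn => ⟨?_, ?_⟩
  · rintro ⟨hM, hc⟩
    have hstep : ∀ i, 0 ≤ i → i + 1 < n →
        natFun π (i + 1) = natFun π i + 1 ∨ natFun π i = natFun π (i + 1) + 1 := by
      intro i _ hi
      obtain ⟨c, h⟩ := hc i (by omega)
      have := hM h
      rw [mem_occs, mem_occ_p12_oneLine, mem_occ_p21_oneLine] at this
      simp only at this
      omega
    -- every position carries a unique occurrence, so `M` consists of all of them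
    have huniq : ∀ g : ℕ → ℕ, occs T₂ (oneLine π) = (range (n - 1)).image (fun j => (j, g j)) →
        M = (range (n - 1)).image (fun j => (j, g j)) := by
      intro g hg
      rw [hg] at hM
      refine Subset.antisymm hM fun p hp => ?_
      rw [mem_image] at hp
      obtain ⟨j, hj, rfl⟩ := hp
      obtain ⟨c, h⟩ := hc j (mem_range.1 hj)
      obtain ⟨i, _, hi'⟩ := mem_image.1 (hM h)
      rw [Prod.mk.injEq] at hi'
      obtain ⟨rfl, rfl⟩ := hi'
      exact h
    rcases natFun_slope le_rfl hstep with h | h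
    · have h0 : π = 1 := by
        refine ext_natFun fun i hi => ?_
        have h1 := h (n - 1) (by omega)
        have h2 := natFun_lt π (show n - 1 < n by omega)
        have h3 := h i (by omega)
        rw [zero_add] at h1 h3
        rw [natFun_one]; omega
      subst h0
      refine Or.inl ⟨rfl, huniq (fun j => j) ?_⟩
      ext p
      rw [mem_occs, occ_p12_one, occ_p21_one]
      simp
    · have h0 : π = Fin.revPerm := by
        refine ext_natFun fun i hi => ?_
        have h1 := h (n - 1) (by omega)
        have h2 := natFun_lt π (show 0 < n by omega)
        have h3 := h i (by omega)
        rw [zero_add] at h1 h3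
        rw [natFun_revPerm hi]; omega
      subst h0
      refine Or.inr ⟨rfl, huniq (fun j => n - 2 - j) ?_⟩
      ext p
      rw [mem_occs, occ_p12_revPerm, occ_p21_revPerm]
      simp
  · rintro (⟨rfl, rfl⟩ | ⟨rfl, rfl⟩)
    · refine ⟨fun p hp => ?_, fun j hj => ⟨j, mem_image.2 ⟨j, mem_range.2 hj, rfl⟩⟩⟩
      rw [mem_occs, occ_p12_one]
      exact Or.inl hp
    · refine ⟨fun p hp => ?_, fun j hj => ⟨n - 2 - j, mem_image.2 ⟨j, mem_range.2 hj, rfl⟩⟩⟩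
      rw [mem_occs, occ_p21_revPerm]
      exact Or.inr hp

theorem one_mem_involutions (n : ℕ) : (1 : Perm (Fin n)) ∈ involutions n := by
  rw [mem_involutions]; intro i; rfl

theorem revPerm_mem_involutions (n : ℕ) : (Fin.revPerm : Perm (Fin n)) ∈ involutions n := by
  rw [mem_involutions]; intro i; simp

theorem IsCluster.mem_involutions {n : ℕ} {π : Perm (Fin n)} {M : Finset (ℕ × ℕ)}
    (h : IsCluster T₂ π M) : π ∈ involutions n := by
  rcases ((isCluster_iff n π M).1 h).2 with ⟨rfl, -⟩ | ⟨rfl, -⟩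
  · exact one_mem_involutions n
  · exact revPerm_mem_involutions n

theorem mem_clusterMarkings {n : ℕ} {π : Perm (Fin n)} {M : Finset (ℕ × ℕ)} :
    M ∈ clusterMarkings T₂ π ↔ IsCluster T₂ π M := by
  simp only [clusterMarkings, mem_filter, mem_powerset, and_iff_right_iff_imp]
  exact fun h => h.2.1.2.2

theorem one_ne_revPerm {n : ℕ} (hn : 2 ≤ n) : (1 : Perm (Fin n)) ≠ Fin.revPerm := by
  intro h
  have h1 : natFun (1 : Perm (Fin n)) 0 = natFun (Fin.revPerm : Perm (Fin n)) 0 := by rw [h]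
  rw [natFun_one, natFun_revPerm (by omega)] at h1
  omega

theorem card_clusterMarkings {n : ℕ} (π : Perm (Fin n)) :
    (clusterMarkings T₂ π).card = if 2 ≤ n ∧ (π = 1 ∨ π = Fin.revPerm) then 1 else 0 := by
  split_ifs with h
  · obtain ⟨hn, rfl | rfl⟩ := h <;> rw [card_eq_one]
    · refine ⟨(range (n - 1)).image fun j => (j, j), ?_⟩
      ext M
      rw [mem_clusterMarkings, isCluster_iff, mem_singleton]
      simp [hn, one_ne_revPerm hn]
    · refine ⟨(range (n - 1)).image fun j => (j, n - 2 - j), ?_⟩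
      ext M
      rw [mem_clusterMarkings, isCluster_iff, mem_singleton]
      simp [hn, (one_ne_revPerm hn).symm]
  · rw [card_eq_zero]
    refine eq_empty_of_forall_notMem fun M hM => h ?_
    rw [mem_clusterMarkings, isCluster_iff] at hM
    exact ⟨hM.1, hM.2.imp And.left And.left⟩


/-! ### Counting occurrences along the positions -/

section Counting

variable {n : ℕ} {π : Perm (Fin n)}

theorem card_filter_occ_p12 (P : ℕ × ℕ → Prop) [DecidablePred P] :
    ((occ p12 (oneLine π)).filter P).card =
      ((range (n - 1)).filter fun i =>
        natFun π (i + 1) = natFun π i + 1 ∧ P (i, natFun π i)).card := by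
  symm
  refine card_bij (fun i _ => (i, natFun π i)) ?_ (fun i _ j _ h => (Prod.ext_iff.1 h).1) ?_
  · intro i hi
    rw [mem_filter, mem_range] at hi
    rw [mem_filter, mem_occ_p12_oneLine]
    exact ⟨⟨by simp only; omega, rfl, hi.2.1⟩, hi.2.2⟩
  · rintro ⟨j, c⟩ hp
    rw [mem_filter, mem_occ_p12_oneLine] at hp
    simp only at hp
    obtain ⟨⟨h1, rfl, h2⟩, h3⟩ := hp
    exact ⟨j, by rw [mem_filter, mem_range]; exact ⟨by omega, h2, h3⟩, rfl⟩

theorem card_filter_occ_p21 (P : ℕ × ℕ → Prop) [DecidablePred P] :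
    ((occ p21 (oneLine π)).filter P).card =
      ((range (n - 1)).filter fun i =>
        natFun π i = natFun π (i + 1) + 1 ∧ P (i, natFun π (i + 1))).card := by
  symm
  refine card_bij (fun i _ => (i, natFun π (i + 1))) ?_ (fun i _ j _ h => (Prod.ext_iff.1 h).1) ?_
  · intro i hi
    rw [mem_filter, mem_range] at hi
    rw [mem_filter, mem_occ_p21_oneLine]
    exact ⟨⟨by simp only; omega, hi.2.1, rfl⟩, hi.2.2⟩
  · rintro ⟨j, c⟩ hp
    rw [mem_filter, mem_occ_p21_oneLine] at hp
    simp only at hp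
    obtain ⟨⟨h1, h2, rfl⟩, h3⟩ := hp
    exact ⟨j, by rw [mem_filter, mem_range]; exact ⟨by omega, h2, h3⟩, rfl⟩

theorem countSib_add_countNsib {k : ℕ} (τ : Perm (Fin k)) (π : Perm (Fin n)) :
    countSib τ π + countNsib τ π = count τ π :=
  card_filter_add_card_filter_not _

theorem swap_mem_occ_p12 (hπ : π ∈ involutions n) {p : ℕ × ℕ}
    (h : p ∈ occ p12 (oneLine π)) : sibling p ∈ occ p12 (oneLine π) := by
  rw [mem_occ_p12_oneLine] at h ⊢
  obtain ⟨h1, h2, h3⟩ := h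
  have h4 := natFun_natFun hπ h1
  have h5 := natFun_natFun hπ (Nat.lt_of_succ_lt h1)
  have h6 := natFun_lt π h1
  rw [h2] at h5
  rw [h3] at h4 h6
  exact ⟨h6, h5, h4⟩

theorem swap_mem_occ_p21 (hπ : π ∈ involutions n) {p : ℕ × ℕ}
    (h : p ∈ occ p21 (oneLine π)) : sibling p ∈ occ p21 (oneLine π) := by
  rw [mem_occ_p21_oneLine] at h ⊢
  obtain ⟨h1, h2, h3⟩ := h
  have h4 := natFun_natFun hπ h1
  have h5 := natFun_natFun hπ (Nat.lt_of_succ_lt h1)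
  have h6 := natFun_lt π (Nat.lt_of_succ_lt h1)
  rw [h2] at h5 h6
  rw [h3] at h4
  exact ⟨h6, h4, h5⟩

/-- The occurrences that differ from their sibling come in pairs. -/
theorem countNsib_eq_two_mul {k : ℕ} {τ : Perm (Fin k)}
    (h : ∀ p ∈ occ τ (oneLine π), sibling p ∈ occ τ (oneLine π)) :
    countNsib τ π = 2 * ((occ τ (oneLine π)).filter fun p => p.1 < p.2).card := by
  have h1 : ((occ τ (oneLine π)).filter fun p => sibling p ≠ p) =
      ((occ τ (oneLine π)).filter fun p => p.1 < p.2) ∪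
        ((occ τ (oneLine π)).filter fun p => p.2 < p.1) := by
    ext ⟨a, b⟩
    rw [mem_filter, mem_union, mem_filter, mem_filter, ← and_or_left]
    refine and_congr_right fun _ => ?_
    simp only [sibling, ne_eq, Prod.mk.injEq]
    omega
  have h2 : Disjoint ((occ τ (oneLine π)).filter fun p => p.1 < p.2)
      ((occ τ (oneLine π)).filter fun p => p.2 < p.1) := by
    rw [disjoint_filter]
    intro p _ h3 h4
    omega
  have h3 : ((occ τ (oneLine π)).filter fun p => p.2 < p.1).card =
      ((occ τ (oneLine π)).filter fun p => p.1 < p.2).card := by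
    refine card_bij (fun p _ => sibling p) ?_ ?_ ?_
    · intro p hp
      rw [mem_filter] at hp ⊢
      exact ⟨h p hp.1, hp.2⟩
    · rintro ⟨a, b⟩ _ ⟨c, d⟩ _ h
      simp only [sibling, Prod.mk.injEq] at h ⊢
      exact h.symm
    · intro p hp
      rw [mem_filter] at hp
      exact ⟨sibling p, mem_filter.2 ⟨h p hp.1, hp.2⟩, rfl⟩
  rw [countNsib, h1, card_union_of_disjoint h2, h3, two_mul]

end Counting

/-- The values of `f` at `i` and `i + 1` are consecutive numbers. -/
abbrev IsAdjacency (f : ℕ → ℕ) (i : ℕ) : Prop :=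
  f (i + 1) = f i + 1 ∨ f i = f (i + 1) + 1


/-- The position of the sibling of an occurrence at position `i`. -/
def siblingPos (f : ℕ → ℕ) (i : ℕ) : ℕ := min (f i) (f (i + 1))

section Weights

variable {R : Type*} [CommRing R]

/-- The weight of an adjacency at `i`: an occurrence of `12` or `21` that is its own sibling has
weight `u₁` or `u₂`; otherwise it has, together with its sibling, weight `q₁` or `q₂`. -/
def siteWeight (u₁ u₂ q₁ q₂ : R) (f : ℕ → ℕ) (i : ℕ) : R :=
  if f (i + 1) = f i + 1 then (if siblingPos f i = i then u₁ else q₁)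
  else (if siblingPos f i = i then u₂ else q₂)

theorem siteWeight_sub_one (u₁ u₂ q₁ q₂ : R) (f : ℕ → ℕ) (i : ℕ) :
    siteWeight u₁ u₂ q₁ q₂ f i = 1 + siteWeight (u₁ - 1) (u₂ - 1) (q₁ - 1) (q₂ - 1) f i := by
  unfold siteWeight
  split_ifs <;> ring

theorem pow_card_filter {ι : Type*} (s : Finset ι) (P : ι → Prop) [DecidablePred P] (u : R) :
    u ^ (s.filter P).card = ∏ i ∈ s, if P i then u else 1 := by
  rw [← prod_filter, prod_const]

/-- The weight of an involution is a product over pairs of siblings. -/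
theorem weight_eq_prod (t u₁ u₂ v₁ v₂ : R) {n : ℕ} {π : Perm (Fin n)} (hπ : π ∈ involutions n) :
    weight t u₁ u₂ v₁ v₂ π = t ^ fp π *
      ∏ i ∈ (range (n - 1)).filter
          (fun i => IsAdjacency (natFun π) i ∧ i ≤ siblingPos (natFun π) i),
        siteWeight u₁ u₂ (v₁ ^ 2) (v₂ ^ 2) (natFun π) i := by
  rw [weight, countNsib_eq_two_mul fun p => swap_mem_occ_p12 hπ,
    countNsib_eq_two_mul fun p => swap_mem_occ_p21 hπ, countSib, countSib, pow_mul, pow_mul,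
    card_filter_occ_p12, card_filter_occ_p12, card_filter_occ_p21, card_filter_occ_p21,
    mul_assoc, pow_card_filter, pow_card_filter, pow_card_filter, pow_card_filter,
    ← prod_mul_distrib, ← prod_mul_distrib, ← prod_mul_distrib, prod_filter]
  congr 1
  refine prod_congr rfl fun i _ => ?_
  set f := natFun π
  simp only [sibling, Prod.mk.injEq]
  by_cases h : IsAdjacency f i ∧ i ≤ siblingPos f i
  · rw [if_pos h]
    unfold siteWeight
    unfold IsAdjacency siblingPos at *
    split_ifs <;> first | (exfalso; omega) | ring
  · rw [if_neg h]
    unfold IsAdjacency siblingPos at h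
    split_ifs <;> first | (exfalso; omega) | ring

/-! ### The generating functions of the clusters -/

/-- The weight of the reversal of a block of `k` positions: `t` for the fixed point in the middle
or `u` for the self-sibling pair in the middle, and `q` for every pair of siblings around it. -/
def reversalWeight (t u q : R) : ℕ → R
  | 0 => 0
  | 1 => t
  | 2 => u
  | k + 3 => q * reversalWeight t u q (k + 1)

theorem reversalWeight_odd (t u q : R) (h : ℕ) : reversalWeight t u q (2 * h + 1) = t * q ^ h := by
  induction h with
  | zero => simp [reversalWeight]
  | succ h ih =>
    rw [show 2 * (h + 1) + 1 = 2 * h + 3 by ring, reversalWeight, ih]; ring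

theorem reversalWeight_even (t u q : R) (h : ℕ) :
    reversalWeight t u q (2 * h + 2) = u * q ^ h := by
  induction h with
  | zero => simp [reversalWeight]
  | succ h ih =>
    rw [show 2 * (h + 1) + 2 = (2 * h + 1) + 3 by ring, reversalWeight, ih]; ring

/-- The generating function of the blocks of size at least two that an involution maps to
themselves, increasingly or decreasingly. -/
noncomputable def clusterSeries (t u₁ u₂ q : R) : R⟦X⟧ :=
  frac (X ^ 2 * C t ^ 2 * C u₁) (1 - X * C t * C u₁) +
    frac ((C u₂ + X * C t * C q) * X ^ 2) (1 - X ^ 2 * C q)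

theorem mk_increasing_eq (t u : R) :
    PowerSeries.mk (fun k => if k < 2 then 0 else t ^ k * u ^ (k - 1)) =
      frac (X ^ 2 * C t ^ 2 * C u) (1 - X * C t * C u) := by
  refine eq_frac_of_mul_eq (by simp) ?_
  have h1 : X * C t * C u = C (t * u) * X := by rw [map_mul]; ring
  have h2 : X ^ 2 * C t ^ 2 * C u = C (t ^ 2 * u) * X ^ 2 := by rw [map_mul, map_pow]; ring
  rw [h1, h2, mul_sub, mul_one, mul_left_comm]
  ext k
  rw [map_sub, coeff_C_mul, coeff_C_mul, coeff_X_pow, coeff_mk]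
  match k with
  | 0 => simp
  | 1 => simp [coeff_succ_mul_X]
  | 2 => simp [coeff_succ_mul_X]
  | k + 3 =>
    rw [coeff_succ_mul_X, coeff_mk, if_neg (by omega), if_neg (by omega), if_neg (by omega)]
    simp only [show k + 3 - 1 = k + 2 by omega,
      show k + 2 - 1 = k + 1 by omega]
    ring

theorem mk_decreasing_eq (t u q : R) :
    PowerSeries.mk (fun k => if k < 2 then 0 else reversalWeight t u q k) =
      frac ((C u + X * C t * C q) * X ^ 2) (1 - X ^ 2 * C q) := by
  refine eq_frac_of_mul_eq (by simp) ?_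
  have h1 : X ^ 2 * C q = C q * X ^ 2 := by ring
  have h2 : (C u + X * C t * C q) * X ^ 2 = C u * X ^ 2 + C (t * q) * X ^ 3 := by
    rw [map_mul]; ring
  rw [h1, h2, mul_sub, mul_one, mul_left_comm]
  ext k
  rw [map_sub, map_add, coeff_C_mul, coeff_C_mul, coeff_C_mul, coeff_X_pow, coeff_X_pow, coeff_mk,
    coeff_mul_X_pow']
  match k with
  | 0 => simp
  | 1 => simp
  | 2 => simp [reversalWeight]
  | 3 => simp [reversalWeight, mul_comm]
  | k + 4 => simp [reversalWeight]

theorem coeff_clusterSeries (t u₁ u₂ q : R) (k : ℕ) : coeff k (clusterSeries t u₁ u₂ q) =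
    if k < 2 then 0 else t ^ k * u₁ ^ (k - 1) + reversalWeight t u₂ q k := by
  rw [clusterSeries, ← mk_increasing_eq, ← mk_decreasing_eq, map_add, coeff_mk, coeff_mk]
  split_ifs <;> simp

theorem weight_one (t u₁ u₂ v₁ v₂ : R) (n : ℕ) :
    weight t u₁ u₂ v₁ v₂ (1 : Perm (Fin n)) = t ^ n * u₁ ^ (n - 1) := by
  have h1 : fp (1 : Perm (Fin n)) = n := by simp [fp]
  have h2 : ∀ p ∈ occ p12 (oneLine (1 : Perm (Fin n))), sibling p = p := by
    rw [occ_p12_one]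
    intro p hp
    obtain ⟨j, _, rfl⟩ := mem_image.1 hp
    rfl
  have h3 : countSib p12 (1 : Perm (Fin n)) = n - 1 := by
    rw [countSib, filter_true_of_mem h2, occ_p12_one,
      card_image_of_injective _ (fun a b h => (Prod.ext_iff.1 h).1), card_range]
  have h4 : countNsib p12 (1 : Perm (Fin n)) = 0 := by
    rw [countNsib, card_eq_zero, filter_eq_empty_iff]
    exact fun p hp => not_not.2 (h2 p hp)
  rw [weight, h1, h3, h4]
  simp [countSib, countNsib, occ_p21_one]

theorem weight_revPerm (t u₁ u₂ v₁ v₂ : R) {n : ℕ} (hn : 0 < n) :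
    weight t u₁ u₂ v₁ v₂ (Fin.revPerm : Perm (Fin n)) = reversalWeight t u₂ (v₂ ^ 2) n := by
  have hinj : Function.Injective fun j : ℕ => (j, n - 2 - j) :=
    fun a b h => (Prod.ext_iff.1 h).1
  have hcount : count p21 (Fin.revPerm : Perm (Fin n)) = n - 1 := by
    rw [count, occ_p21_revPerm, card_image_of_injective _ hinj, card_range]
  have hsib : countSib p21 (Fin.revPerm : Perm (Fin n)) =
      ((range (n - 1)).filter fun j => n - 2 - j = j).card := by
    rw [countSib, occ_p21_revPerm, filter_image, card_image_of_injective _ hinj]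
    congr 1
    ext j
    simp only [mem_filter, sibling, Prod.mk.injEq]
    exact and_congr_right fun _ => ⟨fun h => h.1, fun h => ⟨h, h.symm⟩⟩
  have hadd := countSib_add_countNsib p21 (Fin.revPerm : Perm (Fin n))
  rw [hcount] at hadd
  have hw : weight t u₁ u₂ v₁ v₂ (Fin.revPerm : Perm (Fin n)) =
      t ^ fp (Fin.revPerm : Perm (Fin n)) * u₂ ^ countSib p21 (Fin.revPerm : Perm (Fin n)) *
        v₂ ^ countNsib p21 (Fin.revPerm : Perm (Fin n)) := by
    rw [weight]
    have h1 : countSib p12 (Fin.revPerm : Perm (Fin n)) = 0 := by simp [countSib, occ_p12_revPerm]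
    have h2 : countNsib p12 (Fin.revPerm : Perm (Fin n)) = 0 := by simp [countNsib, occ_p12_revPerm]
    rw [h1, h2]; ring
  rw [hw]
  rcases Nat.even_or_odd' n with ⟨h, rfl | rfl⟩
  · obtain ⟨h, rfl⟩ : ∃ l, h = l + 1 := ⟨h - 1, by omega⟩
    have h1 : ((range (2 * (h + 1) - 1)).filter fun j => 2 * (h + 1) - 2 - j = j) = {h} := by
      ext j; simp only [mem_filter, mem_range, mem_singleton]; omega
    have h2 : fp (Fin.revPerm : Perm (Fin (2 * (h + 1)))) = 0 := by
      rw [fp, card_eq_zero, filter_eq_empty_iff]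
      intro i _ hi
      have := congrArg Fin.val hi
      rw [Fin.revPerm_apply, Fin.val_rev] at this
      omega
    rw [h1, card_singleton] at hsib
    rw [hsib] at hadd
    rw [h2, hsib, show countNsib p21 (Fin.revPerm : Perm (Fin (2 * (h + 1)))) = 2 * h by omega,
      mul_add, mul_one, reversalWeight_even, pow_mul]
    ring
  · have h1 : ((range (2 * h + 1 - 1)).filter fun j => 2 * h + 1 - 2 - j = j) = ∅ := by
      rw [filter_eq_empty_iff]
      intro j hj; rw [mem_range] at hj; omega
    have h2 : fp (Fin.revPerm : Perm (Fin (2 * h + 1))) = 1 := by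
      rw [fp, card_eq_one]
      refine ⟨⟨h, by omega⟩, ?_⟩
      ext i
      simp only [mem_filter, mem_univ, true_and, mem_singleton, Fin.ext_iff, Fin.revPerm_apply,
        Fin.val_rev]
      omega
    rw [h1, card_empty] at hsib
    rw [hsib] at hadd
    rw [h2, hsib, show countNsib p21 (Fin.revPerm : Perm (Fin (2 * h + 1))) = 2 * h by omega,
      reversalWeight_odd, pow_mul]
    ring

theorem involutoryClusterGF_eq_clusterSeries (t u₁ u₂ v₁ v₂ : R) :
    involutoryClusterGF t u₁ u₂ v₁ v₂ = clusterSeries t u₁ u₂ (v₂ ^ 2) := by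
  ext n
  rw [involutoryClusterGF, coeff_mk, coeff_clusterSeries]
  simp only [sum_const, card_clusterMarkings]
  by_cases hn : 2 ≤ n
  · rw [if_neg (by omega)]
    have h1 : ∀ π : Perm (Fin n), (if 2 ≤ n ∧ (π = 1 ∨ π = Fin.revPerm) then 1 else 0) •
        weight t u₁ u₂ v₁ v₂ π = (if π = 1 then weight t u₁ u₂ v₁ v₂ π else 0) +
          (if π = Fin.revPerm then weight t u₁ u₂ v₁ v₂ π else 0) := by
      intro π
      by_cases h1 : π = 1
      · subst h1; simp [hn, one_ne_revPerm hn]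
      · simp [hn, h1]
    rw [sum_congr rfl fun π _ => h1 π, sum_add_distrib, sum_ite_eq', sum_ite_eq',
      if_pos (one_mem_involutions n), if_pos (revPerm_mem_involutions n), weight_one,
      weight_revPerm _ _ _ _ _ (by omega)]
  · rw [if_pos (by omega)]
    simp [hn]

theorem clusterGF_eq (a₁ a₂ : R) : clusterGF a₁ a₂ = involutoryClusterGF 1 a₁ a₂ a₁ a₂ := by
  ext n
  rw [clusterGF, involutoryClusterGF, coeff_mk, coeff_mk]
  have h1 : ∀ π : Perm (Fin n), a₁ ^ count p12 π * a₂ ^ count p21 π =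
      weight 1 a₁ a₂ a₁ a₂ π := by
    intro π
    rw [weight, ← countSib_add_countNsib, ← countSib_add_countNsib, pow_add, pow_add]
    ring
  simp only [h1]
  symm
  refine sum_subset (subset_univ _) fun π _ hπ => ?_
  refine sum_eq_zero fun M hM => ?_
  exact absurd (mem_clusterMarkings.1 hM).mem_involutions hπ

/-! ### The specializations -/

theorem isIrreducible_iff {n : ℕ} {π : Perm (Fin n)} :
    IsIrreducible π ↔ count p12 π = 0 := by
  rw [count, card_eq_zero, eq_empty_iff_forall_notMem, IsIrreducible]
  constructor
  · rintro h ⟨j, c⟩ hp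
    rw [mem_occ_p12_oneLine] at hp
    obtain ⟨h1, h2, h3⟩ := hp
    have := h ⟨j, Nat.lt_of_succ_lt h1⟩ ⟨j + 1, h1⟩ rfl
    rw [natFun_of_lt π h1] at h3
    rw [natFun_of_lt π (Nat.lt_of_succ_lt h1)] at h2
    simp only at h2 h3
    omega
  · intro h i j hij hd
    have hj := j.2
    refine h (i, π i) ?_
    rw [mem_occ_p12_oneLine]
    refine ⟨by simp only; omega, natFun_val π i, ?_⟩
    simp only [← hij, natFun_val]
    omega

theorem isHertzsprungAvoiding_iff {n : ℕ} {π : Perm (Fin n)} :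
    IsHertzsprungAvoiding π ↔ count p12 π = 0 ∧ count p21 π = 0 := by
  rw [← isIrreducible_iff, count, card_eq_zero, eq_empty_iff_forall_notMem]
  constructor
  · refine fun h => ⟨fun i j hij hd => h i j hij (by rw [hd]; rfl), ?_⟩
    rintro ⟨j, c⟩ hp
    rw [mem_occ_p21_oneLine] at hp
    obtain ⟨h1, h2, h3⟩ := hp
    have := h ⟨j, Nat.lt_of_succ_lt h1⟩ ⟨j + 1, h1⟩ rfl
    rw [natFun_of_lt π h1] at h3
    rw [natFun_of_lt π (Nat.lt_of_succ_lt h1)] at h2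
    simp only at h2 h3
    apply this
    rw [h2, h3]
    simp
  · rintro ⟨h1, h2⟩ i j hij hd
    have hj := j.2
    rcases (abs_eq zero_le_one).1 hd with hd | hd
    · exact h1 i j hij hd
    · refine h2 (i, π j) ?_
      rw [mem_occ_p21_oneLine]
      simp only [← hij, natFun_val]
      exact ⟨by omega, by omega, trivial⟩

open Classical in
/-- With the weights `0`, an involution counts `0 ^ 0 = 1` if it has no occurrence and `0` otherwise;
the other specializations are similar. -/
theorem mk_hertzsprung_eq : PowerSeries.mk (fun n =>
    (((involutions n).filter fun π => IsHertzsprungAvoiding π).card : R)) =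
      involutionGF 1 0 0 0 0 := by
  ext n
  rw [involutionGF, coeff_mk, coeff_mk, card_filter, Nat.cast_sum]
  refine sum_congr rfl fun π _ => ?_
  have h1 := countSib_add_countNsib p12 π
  have h2 := countSib_add_countNsib p21 π
  rw [weight, one_pow, one_mul, ← pow_add, ← pow_add, ← pow_add, zero_pow_eq, Nat.cast_ite,
    Nat.cast_one, Nat.cast_zero]
  refine if_congr ?_ rfl rfl
  rw [isHertzsprungAvoiding_iff]
  omega

open Classical in
theorem mk_irreducible_eq : PowerSeries.mk (fun n =>
    (((involutions n).filter fun π => IsIrreducible π).card : R)) =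
      involutionGF 1 0 1 0 1 := by
  ext n
  rw [involutionGF, coeff_mk, coeff_mk, card_filter, Nat.cast_sum]
  refine sum_congr rfl fun π _ => ?_
  rw [weight, one_pow, one_pow, one_pow, one_mul, mul_one, mul_one, ← pow_add,
    countSib_add_countNsib, zero_pow_eq, Nat.cast_ite, Nat.cast_one, Nat.cast_zero]
  exact if_congr isIrreducible_iff rfl rfl

theorem fp_eq_zero_iff {n : ℕ} {π : Perm (Fin n)} : fp π = 0 ↔ ∀ i, π i ≠ i := by
  rw [fp, card_eq_zero, filter_eq_empty_iff]
  simp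

open Classical in
theorem mk_irreducible_derangement_eq : PowerSeries.mk (fun n =>
    (((involutions n).filter fun π => IsIrreducible π ∧ ∀ i, π i ≠ i).card : R)) =
      involutionGF 0 0 1 0 1 := by
  ext n
  rw [involutionGF, coeff_mk, coeff_mk, card_filter, Nat.cast_sum]
  refine sum_congr rfl fun π _ => ?_
  rw [weight, one_pow, one_pow, mul_one, mul_one, mul_assoc, ← pow_add,
    countSib_add_countNsib, ← pow_add, zero_pow_eq, Nat.cast_ite, Nat.cast_one, Nat.cast_zero]
  refine if_congr ?_ rfl rfl
  rw [isIrreducible_iff, ← fp_eq_zero_iff]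
  omega

/-- In an involution, the short pairs are the occurrences of `21` that are their own siblings. -/
theorem countSib_p21_eq_shortPairs {n : ℕ} {π : Perm (Fin n)} (hπ : π ∈ involutions n) :
    countSib p21 π = shortPairs π := by
  rw [countSib, card_filter_occ_p21, shortPairs]
  symm
  refine card_bij (fun i _ => (i : ℕ)) ?_ (fun i _ j _ h => Fin.ext h) ?_
  · intro i hi
    rw [mem_filter] at hi
    have h1 : natFun π i = i + 1 := by rw [natFun_val, hi.2]
    have h2 := natFun_natFun hπ i.2
    have h3 := natFun_lt π i.2
    rw [h1] at h2 h3
    rw [mem_filter, mem_range]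
    exact ⟨by omega, by omega, by simp [sibling, h2]⟩
  · intro j hj
    rw [mem_filter, mem_range] at hj
    obtain ⟨h1, h2, h3⟩ := hj
    simp only [sibling, Prod.mk.injEq] at h3
    refine ⟨⟨j, by omega⟩, ?_, rfl⟩
    rw [mem_filter, ← natFun_of_lt]
    exact ⟨mem_univ _, by simp only; omega⟩

theorem mk_shortPairs_eq (u₂ : R) :
    PowerSeries.mk (fun n => ∑ π ∈ perfectMatchings n, u₂ ^ shortPairs π) =
      involutionGF 0 1 u₂ 1 1 := by
  ext n
  rw [involutionGF, coeff_mk, coeff_mk, perfectMatchings, sum_filter]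
  refine sum_congr rfl fun π hπ => ?_
  rw [weight, countSib_p21_eq_shortPairs hπ, zero_pow_eq]
  simp only [← fp_eq_zero_iff, one_pow, one_mul, mul_one]
  split_ifs <;> simp

end Weights

/-! ### Glued positions -/

section Gluing

variable {R : Type*} [CommRing R]

/-- Expanding a product over the orbits of an involution `s`: a set of orbits is the same as an
`s`-closed set. -/
theorem prod_one_add_orbits {E : Finset ℕ} {s : ℕ → ℕ} (hs : ∀ i ∈ E, s i ∈ E)
    (hss : ∀ i ∈ E, s (s i) = i) (f : ℕ → R) :
    ∏ i ∈ E.filter (fun i => i ≤ s i), (1 + f i) =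
      ∑ S ∈ E.powerset.filter (fun S => ∀ i ∈ S, s i ∈ S), ∏ i ∈ S.filter (fun i => i ≤ s i), f i := by
  rw [prod_one_add]
  refine sum_bij' (fun T _ => E.filter fun i => i ∈ T ∨ s i ∈ T)
    (fun S _ => S.filter fun i => i ≤ s i) ?_ ?_ ?_ ?_ ?_
  · intro T _
    simp only [mem_filter, mem_powerset]
    refine ⟨filter_subset _ _, ?_⟩
    rintro i ⟨hi, h⟩
    rw [hss i hi]
    exact ⟨hs i hi, h.symm⟩
  · intro S hS
    rw [mem_filter, mem_powerset] at hS
    rw [mem_powerset]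
    exact filter_subset_filter _ hS.1
  · intro T hT
    rw [mem_powerset] at hT
    ext i
    simp only [mem_filter]
    constructor
    · rintro ⟨⟨hi, h | h⟩, hle⟩
      · exact h
      · have h1 := (mem_filter.1 (hT h)).2
        rw [hss i hi] at h1
        rwa [le_antisymm hle h1]
    · intro h
      have := mem_filter.1 (hT h)
      exact ⟨⟨this.1, Or.inl h⟩, this.2⟩
  · intro S hS
    rw [mem_filter, mem_powerset] at hS
    ext i
    simp only [mem_filter]
    constructor
    · rintro ⟨hi, h | h⟩
      · exact h.1
      · have := hS.2 _ h.1
        rwa [hss i hi] at this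
    · intro h
      have hi := hS.1 h
      refine ⟨hi, ?_⟩
      rcases le_total i (s i) with h' | h'
      · exact Or.inl ⟨h, h'⟩
      · exact Or.inr ⟨hS.2 i h, by rwa [hss i hi]⟩
  · intro T hT
    rw [mem_powerset] at hT
    refine prod_congr ?_ fun _ _ => rfl
    ext i
    simp only [mem_filter]
    constructor
    · intro h
      have := mem_filter.1 (hT h)
      exact ⟨⟨this.1, Or.inl h⟩, this.2⟩
    · rintro ⟨⟨hi, h | h⟩, hle⟩
      · exact h
      · have h1 := (mem_filter.1 (hT h)).2
        rw [hss i hi] at h1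
        rwa [le_antisymm hle h1]

/-- A set `S` of positions is compatible with `f` if every position in `S` is an adjacency whose
sibling is at a position in `S`. -/
abbrev IsCompatible (f : ℕ → ℕ) (S : Finset ℕ) : Prop :=
  ∀ i ∈ S, IsAdjacency f i ∧ siblingPos f i ∈ S

theorem siblingPos_facts {n : ℕ} {π : Perm (Fin n)} (hπ : π ∈ involutions n) {i : ℕ}
    (hi : i + 1 < n) (h : IsAdjacency (natFun π) i) :
    siblingPos (natFun π) i + 1 < n ∧ IsAdjacency (natFun π) (siblingPos (natFun π) i) ∧
      siblingPos (natFun π) (siblingPos (natFun π) i) = i := by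
  have h1 := natFun_natFun hπ hi
  have h2 := natFun_natFun hπ (Nat.lt_of_succ_lt hi)
  have h3 := natFun_lt π hi
  have h4 := natFun_lt π (Nat.lt_of_succ_lt hi)
  unfold IsAdjacency siblingPos at *
  rcases h with h | h
  · rw [h] at h1 h3 ⊢
    rw [Nat.min_eq_left (Nat.le_succ _), h1, h2]
    omega
  · rw [h] at h2 h4 ⊢
    rw [Nat.min_eq_right (Nat.le_succ _), h1, h2]
    omega

/-- The weight of an involution as a sum over its sets of marked pairs of siblings. -/
theorem weight_eq_sum (t u₁ u₂ v₁ v₂ : R) {n : ℕ} {π : Perm (Fin n)} (hπ : π ∈ involutions n) :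
    weight t u₁ u₂ v₁ v₂ π = ∑ S ∈ (range (n - 1)).powerset.filter (IsCompatible (natFun π)),
      t ^ fp π * ∏ i ∈ S.filter (fun i => i ≤ siblingPos (natFun π) i),
        siteWeight (u₁ - 1) (u₂ - 1) (v₁ ^ 2 - 1) (v₂ ^ 2 - 1) (natFun π) i := by
  rw [weight_eq_prod t u₁ u₂ v₁ v₂ hπ, ← mul_sum, ← filter_filter]
  congr 1
  simp only [siteWeight_sub_one u₁]
  have hE : ∀ i ∈ (range (n - 1)).filter (IsAdjacency (natFun π)),
      i + 1 < n ∧ IsAdjacency (natFun π) i := by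
    intro i hi
    rw [mem_filter, mem_range] at hi
    exact ⟨by omega, hi.2⟩
  rw [prod_one_add_orbits]
  · refine sum_congr ?_ fun _ _ => rfl
    ext S
    simp only [mem_filter, mem_powerset, IsCompatible, subset_iff]
    constructor
    · rintro ⟨h1, h2⟩
      exact ⟨fun i hi => (h1 hi).1, fun i hi => ⟨(h1 hi).2, h2 i hi⟩⟩
    · rintro ⟨h1, h2⟩
      exact ⟨fun i hi => ⟨h1 hi, (h2 i hi).1⟩, fun i hi => (h2 i hi).2⟩
  · intro i hi
    have := hE i hi
    have := siblingPos_facts hπ this.1 this.2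
    rw [mem_filter, mem_range]
    exact ⟨by omega, this.2.1⟩
  · intro i hi
    have := hE i hi
    exact (siblingPos_facts hπ this.1 this.2).2.2

end Gluing

/-! ### Compositions and their blocks -/

section Blocks

variable {n : ℕ} (c : Composition n)

/-- The positions `i` such that `i` and `i + 1` lie in the same block of the composition. -/
def glue : Finset ℕ :=
  (range (n - 1)).filter fun i => ∀ a ≤ c.length, c.sizeUpTo a ≠ i + 1

theorem sizeUpTo_succ_eq (a : Fin c.length) :
    c.sizeUpTo ((a : ℕ) + 1) = c.sizeUpTo a + c.blocksFun a := c.sizeUpTo_succ' a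

theorem sizeUpTo_add_le (a : Fin c.length) : c.sizeUpTo a + c.blocksFun a ≤ n := by
  rw [← sizeUpTo_succ_eq]; exact c.sizeUpTo_le _

theorem sizeUpTo_add_le_of_lt {a a' : Fin c.length} (h : a < a') :
    c.sizeUpTo a + c.blocksFun a ≤ c.sizeUpTo a' := by
  rw [← sizeUpTo_succ_eq]
  exact c.monotone_sizeUpTo (Nat.succ_le_of_lt h)

theorem block_unique {a a' : Fin c.length} {i : ℕ} (h1 : c.sizeUpTo a ≤ i)
    (h2 : i < c.sizeUpTo a + c.blocksFun a) (h3 : c.sizeUpTo a' ≤ i)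
    (h4 : i < c.sizeUpTo a' + c.blocksFun a') : a = a' := by
  rcases lt_trichotomy a a' with h | h | h
  · have := sizeUpTo_add_le_of_lt c h; omega
  · exact h
  · have := sizeUpTo_add_le_of_lt c h; omega

theorem exists_block {i : ℕ} (hi : i < n) :
    ∃ a : Fin c.length, c.sizeUpTo a ≤ i ∧ i < c.sizeUpTo a + c.blocksFun a := by
  refine ⟨c.index ⟨i, hi⟩, c.sizeUpTo_index_le ⟨i, hi⟩, ?_⟩
  rw [← sizeUpTo_succ_eq]
  exact c.lt_sizeUpTo_index_succ ⟨i, hi⟩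

theorem mem_glue_iff {i : ℕ} : i ∈ glue c ↔
    ∃ a : Fin c.length, c.sizeUpTo a ≤ i ∧ i + 1 < c.sizeUpTo a + c.blocksFun a := by
  rw [glue, mem_filter, mem_range]
  constructor
  · rintro ⟨h1, h2⟩
    obtain ⟨a, h3, h4⟩ := exists_block c (show i < n by omega)
    have h5 := h2 (a + 1) a.2
    rw [sizeUpTo_succ_eq] at h5
    exact ⟨a, h3, by omega⟩
  · rintro ⟨a, h1, h2⟩
    have h3 := sizeUpTo_add_le c a
    refine ⟨by omega, fun b _ h4 => ?_⟩
    rcases Nat.lt_or_ge a b with h | h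
    · have := c.monotone_sizeUpTo (Nat.succ_le_of_lt h)
      rw [Nat.succ_eq_add_one, sizeUpTo_succ_eq] at this
      omega
    · have := c.monotone_sizeUpTo h
      omega

theorem mem_glue_block (a : Fin c.length) {r : ℕ} (hr : r < c.blocksFun a) :
    c.sizeUpTo a + r ∈ glue c ↔ r + 1 < c.blocksFun a := by
  rw [mem_glue_iff]
  constructor
  · rintro ⟨a', h1, h2⟩
    obtain rfl := block_unique c h1 (by omega) (Nat.le_add_right _ _)
      (show c.sizeUpTo a + r < c.sizeUpTo a + c.blocksFun a by omega)
    omega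
  · intro h
    exact ⟨a, by omega, by omega⟩

theorem mem_boundaries_iff (x : Fin (n + 1)) :
    x ∈ c.boundaries ↔ (x : ℕ) = 0 ∨ (x : ℕ) = n ∨ (x : ℕ) - 1 ∉ glue c := by
  have h : x ∈ c.boundaries ↔ ∃ a ≤ c.length, c.sizeUpTo a = x := by
    simp only [Composition.boundaries, mem_map, mem_univ, true_and]
    constructor
    · rintro ⟨a, rfl⟩
      exact ⟨a, Nat.le_of_lt_succ a.2, rfl⟩
    · rintro ⟨a, ha, h⟩
      exact ⟨⟨a, Nat.lt_succ_of_le ha⟩, Fin.ext h⟩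
  rw [h, glue, mem_filter, mem_range]
  have hx := x.2
  constructor
  · rintro ⟨a, ha, h1⟩
    by_cases h0 : (x : ℕ) = 0
    · exact Or.inl h0
    · refine Or.inr (Or.inr fun h2 => h2.2 a ha ?_)
      omega
  · rintro (h0 | h0 | h0)
    · exact ⟨0, Nat.zero_le _, by simp [h0]⟩
    · exact ⟨c.length, le_rfl, by simp [h0]⟩
    · by_contra h1
      push Not at h1
      have h2 := h1 0 (Nat.zero_le _)
      have h3 := h1 c.length le_rfl
      rw [c.sizeUpTo_zero] at h2
      rw [c.sizeUpTo_length] at h3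
      refine h0 ⟨by omega, fun a ha h4 => h1 a ha (by omega)⟩

theorem glue_injective : Function.Injective (glue : Composition n → Finset ℕ) := by
  intro c c' h
  apply (compositionEquiv n).injective
  apply CompositionAsSet.ext
  change c.boundaries = c'.boundaries
  ext x
  rw [mem_boundaries_iff, mem_boundaries_iff, h]

/-- Compositions of `n` correspond to sets of glued positions. -/
theorem sum_composition_glue {M : Type*} [AddCommMonoid M] (g : Finset ℕ → M) :
    ∑ c : Composition n, g (glue c) = ∑ S ∈ (range (n - 1)).powerset, g S := by
  have h : (range (n - 1)).powerset = univ.image (glue : Composition n → Finset ℕ) := by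
    symm
    refine eq_of_subset_of_card_le ?_ ?_
    · intro S hS
      obtain ⟨c, _, rfl⟩ := mem_image.1 hS
      exact mem_powerset.2 (filter_subset _ _)
    · rw [card_image_of_injective _ glue_injective, card_univ, composition_card, card_powerset,
        card_range]
  rw [h, sum_image fun _ _ _ _ h => glue_injective h]

theorem prod_range_eq_prod_blocks {M : Type*} [CommMonoid M] (h : ℕ → M) :
    ∏ i ∈ range n, h i =
      ∏ a : Fin c.length, ∏ r ∈ range (c.blocksFun a), h (c.sizeUpTo a + r) := by
  rw [← Fin.prod_univ_eq_prod_range, ← c.prod_prod_apply_embedding]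
  refine prod_congr rfl fun a _ => ?_
  rw [← Fin.prod_univ_eq_prod_range (fun r => h (c.sizeUpTo a + r))]
  rfl

/-! ### Involutions that permute the blocks of a composition -/

variable (σ : Perm (Fin c.length)) (d : Fin c.length → Bool)

/-- Blocks of sizes `k` can be permuted by the involution `σ`, the block `a` being mapped
increasingly to its image if `d a = true` and decreasingly otherwise: sizes and directions are
constant on the orbits of `σ`. The direction of a block of size one is `true` by convention, so
that it is determined by the permutation of the positions. -/
def IsBlockInvolution {m : ℕ} (k : Fin m → ℕ) (σ : Perm (Fin m)) (d : Fin m → Bool) : Prop :=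
  (∀ a, k (σ a) = k a) ∧ (∀ a, d (σ a) = d a) ∧ ∀ a, k a = 1 → d a = true

/-- `π` maps the block `a` to the block `σ a`, increasingly or decreasingly according to `d a`. -/
def IsInflation (π : Perm (Fin n)) : Prop :=
  ∀ a : Fin c.length, ∀ r < c.blocksFun a, natFun π (c.sizeUpTo a + r) =
    c.sizeUpTo (σ a) + if d a = true then r else c.blocksFun a - 1 - r

variable {c σ d}

theorem exists_isInflation (hσ : σ ∈ involutions c.length)
    (h : IsBlockInvolution c.blocksFun σ d) : ∃ π ∈ involutions n, IsInflation c σ d π := by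
  obtain ⟨hk, hd, -⟩ := h
  have hex : ∀ i : Fin n, ∃ j : Fin n, ∀ a : Fin c.length, ∀ r < c.blocksFun a,
      (i : ℕ) = c.sizeUpTo a + r →
        (j : ℕ) = c.sizeUpTo (σ a) + if d a = true then r else c.blocksFun a - 1 - r := by
    intro i
    obtain ⟨a, h1, h2⟩ := exists_block c i.2
    have h3 := sizeUpTo_add_le c (σ a)
    rw [hk] at h3
    refine ⟨⟨c.sizeUpTo (σ a) + if d a = true then i - c.sizeUpTo a else
      c.blocksFun a - 1 - (i - c.sizeUpTo a), by split_ifs <;> omega⟩, ?_⟩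
    intro a' r hr hi
    obtain rfl := block_unique c h1 h2 (show c.sizeUpTo a' ≤ i by omega) (by omega)
    dsimp only
    split_ifs <;> omega
  choose g hg using hex
  have hgg : Function.Involutive g := by
    intro i
    obtain ⟨a, h1, h2⟩ := exists_block c i.2
    obtain ⟨r, hr⟩ := Nat.exists_eq_add_of_le h1
    have h3 := hg i a r (by omega) hr
    have h4 := hg (g i) (σ a) _ (by rw [hk]; split_ifs <;> omega) h3
    rw [mem_involutions.1 hσ, hd, hk] at h4
    apply Fin.ext
    rw [h4, hr]
    split_ifs <;> omega
  refine ⟨hgg.toPerm, mem_involutions.2 hgg, fun a r hr => ?_⟩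
  have h1 := sizeUpTo_add_le c a
  rw [natFun_of_lt _ (show c.sizeUpTo a + r < n by omega)]
  exact hg _ a r hr rfl

theorem IsInflation.perm_unique {π π' : Perm (Fin n)} (h : IsInflation c σ d π)
    (h' : IsInflation c σ d π') : π = π' := by
  refine ext_natFun fun i hi => ?_
  obtain ⟨a, h1, h2⟩ := exists_block c hi
  obtain ⟨r, rfl⟩ := Nat.exists_eq_add_of_le h1
  rw [h a r (by omega), h' a r (by omega)]

theorem IsInflation.data_unique {σ' : Perm (Fin c.length)} {d' : Fin c.length → Bool}
    {π : Perm (Fin n)} (h : IsInflation c σ d π) (h' : IsInflation c σ' d' π)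
    (hv : IsBlockInvolution c.blocksFun σ d) (hv' : IsBlockInvolution c.blocksFun σ' d') :
    σ = σ' ∧ d = d' := by
  have hσ : σ = σ' := by
    ext1 a
    have h0 := c.one_le_blocksFun a
    have h1 := h a 0 h0
    have h2 := h' a 0 h0
    have h3 := hv.1 a
    have h4 := hv'.1 a
    refine block_unique c (i := natFun π (c.sizeUpTo a + 0)) ?_ ?_ ?_ ?_
    · omega
    · rw [h1]; split_ifs <;> omega
    · omega
    · rw [h2]; split_ifs <;> omega
  subst hσ
  refine ⟨rfl, ?_⟩
  ext1 a
  by_cases hk : c.blocksFun a = 1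
  · rw [hv.2.2 a hk, hv'.2.2 a hk]
  · have h0 := c.one_le_blocksFun a
    have h1 := h a 0 h0
    rw [h' a 0 h0] at h1
    cases hda : d a <;> cases hda' : d' a <;> simp [hda, hda'] at h1 ⊢ <;> omega

theorem IsInflation.isCompatible {π : Perm (Fin n)} (h : IsInflation c σ d π)
    (hv : IsBlockInvolution c.blocksFun σ d) : IsCompatible (natFun π) (glue c) := by
  intro i hi
  obtain ⟨a, h1, h2⟩ := (mem_glue_iff c).1 hi
  obtain ⟨r, rfl⟩ := Nat.exists_eq_add_of_le h1
  have h3 := h a r (by omega)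
  have h4 := h a (r + 1) (by omega)
  have h5 := hv.1 a
  unfold IsAdjacency siblingPos
  rw [mem_glue_iff]
  rw [← add_assoc] at h4
  rw [h3, h4]
  constructor
  · split_ifs <;> omega
  · refine ⟨σ a, ?_⟩
    split_ifs <;> omega

/-- An involution that is compatible with the glued positions of a composition permutes the
blocks: on every block it has constant slope and stays inside one block. -/
theorem exists_isBlockInvolution {π : Perm (Fin n)} (hπ : π ∈ involutions n)
    (hc : IsCompatible (natFun π) (glue c)) :
    ∃ σ ∈ involutions c.length, ∃ d, IsBlockInvolution c.blocksFun σ d ∧ IsInflation c σ d π := by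
  have hlt : ∀ a : Fin c.length, ∀ r < c.blocksFun a, c.sizeUpTo a + r < n := fun a r hr => by
    have := sizeUpTo_add_le c a; omega
  -- siblings of glued positions are glued, so the image of a block does not leave a block
  have hex : ∀ a : Fin c.length, ∃ b : Fin c.length, ∀ r < c.blocksFun a,
      c.sizeUpTo b ≤ natFun π (c.sizeUpTo a + r) ∧
        natFun π (c.sizeUpTo a + r) < c.sizeUpTo b + c.blocksFun b := by
    intro a
    obtain ⟨b, hb⟩ := exists_block c (natFun_lt π (hlt a 0 (c.one_le_blocksFun a)))
    refine ⟨b, fun r => ?_⟩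
    induction r with
    | zero => intro _; exact hb
    | succ r ih =>
      intro hr
      have h1 := ih (by omega)
      obtain ⟨h2, h3⟩ := hc _ ((mem_glue_block c a (by omega)).2 hr)
      obtain ⟨b', h4, h5⟩ := (mem_glue_iff c).1 h3
      unfold IsAdjacency at h2
      unfold siblingPos at h4 h5
      rw [← add_assoc]
      obtain rfl : b = b' := by
        refine block_unique c h1.1 h1.2 ?_ ?_ <;> omega
      omega
  choose s hs using hex
  -- `π` maps the first position of the block `a` to the block `s a`, and back
  have hss : Function.Involutive s := by
    intro a
    have h0 := c.one_le_blocksFun a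
    have h1 := hs a 0 h0
    obtain ⟨r, hr⟩ := Nat.exists_eq_add_of_le h1.1
    have h2 := hs (s a) r (by omega)
    rw [← hr, natFun_natFun hπ (hlt a 0 h0)] at h2
    exact block_unique c h2.1 h2.2 (by omega) (by omega)
  have hslope : ∀ a : Fin c.length, _ := fun a =>
    natFun_slope (π := π) (a := c.sizeUpTo a) (sizeUpTo_add_le c a) fun i h1 h2 =>
      (hc i ((mem_glue_iff c).2 ⟨a, h1, h2⟩)).1
  -- the slope is `1` or `-1` on the block `a`, whose image therefore fills an interval of its size
  have hle : ∀ a, c.blocksFun a ≤ c.blocksFun (s a) := by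
    intro a
    have h0 := c.one_le_blocksFun a
    have h1 := hs a 0 h0
    have h2 := hs a (c.blocksFun a - 1) (by omega)
    rw [add_zero] at h1
    rcases hslope a with h | h
    · have := h (c.blocksFun a - 1) (by omega); omega
    · have := h (c.blocksFun a - 1) (by omega); omega
  have hk : ∀ a, c.blocksFun (s a) = c.blocksFun a := fun a =>
    le_antisymm (by simpa [hss a] using hle (s a)) (hle a)
  refine ⟨hss.toPerm, mem_involutions.2 hss,
    fun a => decide (natFun π (c.sizeUpTo a) = c.sizeUpTo (s a)), ⟨hk, ?_, ?_⟩, ?_⟩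
  · intro a
    rw [decide_eq_decide]
    change natFun π (c.sizeUpTo (s a)) = c.sizeUpTo (s (s a)) ↔ _
    rw [hss a]
    have h1 := natFun_natFun hπ (hlt a 0 (c.one_le_blocksFun a))
    have h2 := natFun_natFun hπ (hlt (s a) 0 (c.one_le_blocksFun (s a)))
    rw [add_zero] at h1 h2
    constructor
    · intro h; rw [← h, h2]
    · intro h; rw [← h, h1]
  · intro a ha
    have h1 := hs a 0 (by omega)
    rw [hk, add_zero] at h1
    rw [decide_eq_true_iff]
    omega
  · intro a r hr
    change _ = c.sizeUpTo (s a) + _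
    have h0 := hs a 0 (by omega)
    have h1 := hs a r hr
    have h2 := hs a (c.blocksFun a - 1) (by omega)
    rw [hk] at h0 h1 h2
    rw [add_zero] at h0
    simp only [decide_eq_true_eq]
    rcases hslope a with h | h
    · have h3 := h r (by omega)
      have h4 := h (c.blocksFun a - 1) (by omega)
      split_ifs <;> omega
    · have h3 := h r (by omega)
      have h4 := h (c.blocksFun a - 1) (by omega)
      split_ifs <;> omega

end Blocks

/-! ### The weight of an inflation -/

section InflationWeight

variable {R : Type*} [CommRing R]

/-- The weight of a block of size `k.1` that is mapped to itself, increasingly if `k.2 = true`. -/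
def fixedBlockWeight (t u₁ u₂ q₂ : R) (k : ℕ × Bool) : R :=
  if k.2 = true then t ^ k.1 * u₁ ^ (k.1 - 1) else reversalWeight t u₂ q₂ k.1

/-- The weight of a pair of blocks of size `k.1` that are exchanged. -/
def swappedBlockWeight (q₁ q₂ : R) (k : ℕ × Bool) : R :=
  if k.2 = true then q₁ ^ (k.1 - 1) else q₂ ^ (k.1 - 1)

theorem prod_range_adjacency (q : R) (k : ℕ) :
    ∏ r ∈ range k, (if r + 1 < k then q else 1) = q ^ (k - 1) := by
  cases k with
  | zero => simp
  | succ k =>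
    rw [prod_range_succ, if_neg (by omega), mul_one, Nat.add_sub_cancel]
    rw [prod_congr rfl fun r hr => if_pos (by rw [mem_range] at hr; omega), prod_const, card_range]

theorem prod_range_reversal (t u q : R) {k : ℕ} (hk : 0 < k) :
    ∏ r ∈ range k, ((if 2 * r + 1 = k then t else 1) *
      if 2 * r + 2 ≤ k then (if 2 * r + 2 = k then u else q) else 1) = reversalWeight t u q k := by
  match k with
  | 1 => simp [reversalWeight]
  | 2 => simp [reversalWeight]
  | k + 3 =>
    rw [reversalWeight, ← prod_range_reversal t u q (Nat.succ_pos k), prod_range_succ,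
      prod_range_succ', mul_comm q, if_neg (show ¬ 2 * (k + 2) + 1 = k + 3 by omega),
      if_neg (show ¬ 2 * (k + 2) + 2 ≤ k + 3 by omega), if_neg (show ¬ 2 * 0 + 1 = k + 3 by omega),
      if_pos (show 2 * 0 + 2 ≤ k + 3 by omega), if_neg (show ¬ 2 * 0 + 2 = k + 3 by omega)]
    simp only [mul_one, one_mul]
    congr 1
    refine prod_congr rfl fun r _ => ?_
    congr 1
    · exact if_congr (by omega) rfl rfl
    · exact if_congr (by omega) (if_congr (by omega) rfl rfl) rfl

variable {n : ℕ} {c : Composition n} {σ : Perm (Fin c.length)} {d : Fin c.length → Bool}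
  {π : Perm (Fin n)}

/-- The contribution of the position `i` to the weight of a marked involution. -/
def positionWeight (t u₁ u₂ q₁ q₂ : R) (f : ℕ → ℕ) (S : Finset ℕ) (i : ℕ) : R :=
  (if f i = i then t else 1) *
    if i ∈ S ∧ i ≤ siblingPos f i then siteWeight u₁ u₂ q₁ q₂ f i else 1

theorem prod_positionWeight (t u₁ u₂ q₁ q₂ : R) {S : Finset ℕ} (hS : S ⊆ range n) :
    t ^ fp π * ∏ i ∈ S.filter (fun i => i ≤ siblingPos (natFun π) i),
      siteWeight u₁ u₂ q₁ q₂ (natFun π) i =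
    ∏ i ∈ range n, positionWeight t u₁ u₂ q₁ q₂ (natFun π) S i := by
  unfold positionWeight
  rw [prod_mul_distrib]
  congr 1
  · rw [← Fin.prod_univ_eq_prod_range (fun i => if natFun π i = i then t else 1), fp,
      pow_card_filter]
    refine prod_congr rfl fun i _ => if_congr ?_ rfl rfl
    rw [natFun_val, Fin.ext_iff]
  · rw [← prod_filter]
    refine prod_congr ?_ fun _ _ => rfl
    ext i
    simp only [mem_filter]
    exact ⟨fun h => ⟨hS h.1, h⟩, fun h => h.2⟩

/-- Both blocks of an exchanged pair contain marked occurrences; the weight is attributed to the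
block on the left. -/
theorem prod_block_positionWeight (t u₁ u₂ q₁ q₂ : R) (h : IsInflation c σ d π)
    (hv : IsBlockInvolution c.blocksFun σ d) (a : Fin c.length) :
    ∏ r ∈ range (c.blocksFun a),
        positionWeight t u₁ u₂ q₁ q₂ (natFun π) (glue c) (c.sizeUpTo a + r) =
      if a ≤ σ a then
        (if σ a = a then fixedBlockWeight t u₁ u₂ q₂ (c.blocksFun a, d a)
          else swappedBlockWeight q₁ q₂ (c.blocksFun a, d a)) else 1 := by
  have hf : ∀ r < c.blocksFun a, _ := h a
  have hk := hv.1 a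
  have hpos := c.one_le_blocksFun a
  have hw : ∀ r < c.blocksFun a,
      positionWeight t u₁ u₂ q₁ q₂ (natFun π) (glue c) (c.sizeUpTo a + r) =
        (if natFun π (c.sizeUpTo a + r) = c.sizeUpTo a + r then t else 1) *
          if r + 1 < c.blocksFun a ∧ c.sizeUpTo a + r ≤ siblingPos (natFun π) (c.sizeUpTo a + r)
          then siteWeight u₁ u₂ q₁ q₂ (natFun π) (c.sizeUpTo a + r) else 1 := fun r hr =>
    congrArg _ (if_congr (and_congr_left' (mem_glue_block c a hr)) rfl rfl)
  set k := c.blocksFun a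
  set b := c.sizeUpTo a
  have hstep : ∀ r, r + 1 < k → natFun π (b + r + 1) =
      c.sizeUpTo (σ a) + if d a = true then r + 1 else k - 1 - (r + 1) := fun r hr => hf (r + 1) hr
  rcases lt_trichotomy a (σ a) with hlt | heq | hgt
  · have hb := sizeUpTo_add_le_of_lt c hlt
    rw [if_pos hlt.le, if_neg hlt.ne']
    have hq : swappedBlockWeight q₁ q₂ (k, d a) = (if d a = true then q₁ else q₂) ^ (k - 1) := by
      unfold swappedBlockWeight; split_ifs <;> rfl
    rw [hq, ← prod_range_adjacency]
    refine prod_congr rfl fun r hr => ?_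
    rw [mem_range] at hr
    have h0 := hf r hr
    rw [hw r hr, if_neg (by rw [h0]; omega), one_mul]
    by_cases hr1 : r + 1 < k
    · have h1 := hstep r hr1
      unfold siteWeight siblingPos
      rw [h0, h1]
      by_cases hd : d a = true
      · simp only [hd, if_true]
        rw [if_pos (by omega), if_pos (by omega), if_neg (by omega), if_pos hr1]
      · simp only [hd]
        rw [if_pos (by omega), if_neg (by simp; omega), if_neg (by simp; omega), if_pos hr1]
        simp
    · rw [if_neg (by tauto), if_neg hr1]
  · rw [if_pos heq.le, if_pos heq.symm]
    rw [← heq] at hf hstep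
    by_cases hd : d a = true
    · simp only [hd, if_true] at hf hstep
      simp only [fixedBlockWeight, hd, if_true]
      rw [← prod_range_adjacency, ← card_range k, ← prod_const, card_range, ← prod_mul_distrib]
      refine prod_congr rfl fun r hr => ?_
      rw [mem_range] at hr
      have h0 : natFun π (b + r) = b + r := hf r hr
      rw [hw r hr, if_pos h0]
      by_cases hr1 : r + 1 < k
      · have h1 : natFun π (b + r + 1) = b + (r + 1) := hstep r hr1
        unfold siteWeight siblingPos
        rw [h0, h1, if_pos (by omega), if_pos (by omega), if_pos (by omega), if_pos hr1]
      · rw [if_neg (by tauto), if_neg hr1]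
    · simp only [hd] at hf hstep
      simp only [fixedBlockWeight, hd]
      simp only [Bool.false_eq_true, if_false] at hf hstep ⊢
      rw [← prod_range_reversal t u₂ q₂ hpos]
      refine prod_congr rfl fun r hr => ?_
      rw [mem_range] at hr
      have h0 : natFun π (b + r) = b + (k - 1 - r) := hf r hr
      rw [hw r hr]
      congr 1
      · exact if_congr (by rw [h0]; omega) rfl rfl
      · by_cases hr1 : r + 1 < k
        · have h1 : natFun π (b + r + 1) = b + (k - 1 - (r + 1)) := hstep r hr1
          unfold siteWeight siblingPos
          rw [h0, h1]
          rw [if_neg (show ¬ b + (k - 1 - (r + 1)) = b + (k - 1 - r) + 1 by omega)]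
          exact if_congr (by omega) (if_congr (by omega) rfl rfl) rfl
        · rw [if_neg (by tauto), if_neg (by omega)]
  · have hb := sizeUpTo_add_le_of_lt c hgt
    rw [if_neg (not_le.2 hgt)]
    refine prod_eq_one fun r hr => ?_
    rw [mem_range] at hr
    have h0 := hf r hr
    rw [hw r hr, if_neg (by rw [h0]; split_ifs <;> omega), one_mul, if_neg]
    unfold siblingPos
    rw [h0]
    rintro ⟨-, h1⟩
    split_ifs at h1 <;> omega

open Classical in
/-- The weighted sum over the involutions of `m` blocks of sizes `k`, with directions. -/
noncomputable def blockSum (t u₁ u₂ q₁ q₂ : R) (m : ℕ) (k : Fin m → ℕ) : R :=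
  ∑ σ ∈ involutions m, ∑ d : Fin m → Bool, if IsBlockInvolution k σ d then
    ∏ a ∈ univ.filter (fun a => a ≤ σ a),
      (if σ a = a then fixedBlockWeight t u₁ u₂ q₂ (k a, d a)
        else swappedBlockWeight q₁ q₂ (k a, d a)) else 0

theorem sum_compatible_eq_blockSum (t u₁ u₂ q₁ q₂ : R) (c : Composition n) :
    ∑ π ∈ (involutions n).filter (fun π => IsCompatible (natFun π) (glue c)),
      t ^ fp π * ∏ i ∈ (glue c).filter (fun i => i ≤ siblingPos (natFun π) i),
        siteWeight u₁ u₂ q₁ q₂ (natFun π) i = blockSum t u₁ u₂ q₁ q₂ c.length c.blocksFun := by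
  classical
  rw [blockSum, ← sum_product', ← sum_filter]
  symm
  have hmem : ∀ p : Perm (Fin c.length) × (Fin c.length → Bool),
      p ∈ ((involutions c.length) ×ˢ univ).filter
        (fun p => IsBlockInvolution c.blocksFun p.1 p.2) ↔
      p.1 ∈ involutions c.length ∧ IsBlockInvolution c.blocksFun p.1 p.2 := by
    intro p
    rw [mem_filter, mem_product]
    simp
  have hex := fun p (hp : p ∈ ((involutions c.length) ×ˢ univ).filter
      (fun p => IsBlockInvolution c.blocksFun p.1 p.2)) =>
    exists_isInflation ((hmem p).1 hp).1 ((hmem p).1 hp).2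
  choose F hF hFi using hex
  refine sum_bij F ?_ ?_ ?_ ?_
  · intro p hp
    rw [mem_filter]
    exact ⟨hF p hp, (hFi p hp).isCompatible ((hmem p).1 hp).2⟩
  · intro p hp p' hp' h
    have h1 := hFi p hp
    rw [h] at h1
    have := h1.data_unique (hFi p' hp') ((hmem p).1 hp).2 ((hmem p').1 hp').2
    exact Prod.ext this.1 this.2
  · intro π hπ
    rw [mem_filter] at hπ
    obtain ⟨σ, hσ, d, hv, hi⟩ := exists_isBlockInvolution hπ.1 hπ.2
    exact ⟨(σ, d), (hmem _).2 ⟨hσ, hv⟩, (hFi _ _).perm_unique hi⟩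
  · intro p hp
    have hsub : glue c ⊆ range n := fun i hi => by
      have := mem_range.1 (mem_filter.1 hi).1
      rw [mem_range]; omega
    rw [prod_positionWeight _ _ _ _ _ hsub, prod_range_eq_prod_blocks c, prod_filter]
    refine prod_congr rfl fun a _ => ?_
    rw [prod_block_positionWeight _ _ _ _ _ (hFi p hp) ((hmem p).1 hp).2]

/-- The total weight of the involutions of length `n`, sorted by the composition whose blocks are
the runs of positions joined by marked adjacencies. -/
theorem coeff_involutionGF (t u₁ u₂ v₁ v₂ : R) (n : ℕ) :
    coeff n (involutionGF t u₁ u₂ v₁ v₂) = ∑ c : Composition n,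
      blockSum t (u₁ - 1) (u₂ - 1) (v₁ ^ 2 - 1) (v₂ ^ 2 - 1) c.length c.blocksFun := by
  rw [involutionGF, coeff_mk, sum_congr rfl fun π hπ => weight_eq_sum t u₁ u₂ v₁ v₂ hπ]
  simp only [← sum_compatible_eq_blockSum, sum_filter]
  rw [sum_composition_glue (fun S => ∑ π ∈ involutions n, if IsCompatible (natFun π) S then
    t ^ fp π * ∏ i ∈ S.filter (fun i => i ≤ siblingPos (natFun π) i),
        siteWeight (u₁ - 1) (u₂ - 1) (v₁ ^ 2 - 1) (v₂ ^ 2 - 1) (natFun π) i else 0)]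
  exact sum_comm

end InflationWeight

/-! ### Decorated involutions -/

section Decorated

/-- Expanding the weight of an involution whose fixed points and `2`-cycles carry decorations from
`D`: a decoration of the orbits is an invariant decoration of the points. -/
theorem pow_fp_mul_pow_twoCycles {S ι : Type*} [CommRing S] [DecidableEq ι] {m : ℕ}
    {σ : Perm (Fin m)} (hσ : σ ∈ involutions m) (D : Finset ι) (f g : ι → S) :
    (∑ d ∈ D, f d) ^ fp σ * (∑ d ∈ D, g d) ^ twoCycles σ =
      ∑ d ∈ (Fintype.piFinset fun _ : Fin m => D).filter (fun d => ∀ a, d (σ a) = d a),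
        ∏ a ∈ univ.filter (fun a => a ≤ σ a), (if σ a = a then f (d a) else g (d a)) := by
  have hσ' := mem_involutions.1 hσ
  have h1 : (∑ d ∈ D, f d) ^ fp σ * (∑ d ∈ D, g d) ^ twoCycles σ =
      ∏ a ∈ univ.filter (fun a => a ≤ σ a), ∑ d ∈ D, (if σ a = a then f d else g d) := by
    rw [prod_congr rfl fun a _ => show (∑ d ∈ D, if σ a = a then f d else g d) =
        if σ a = a then ∑ d ∈ D, f d else ∑ d ∈ D, g d by split_ifs <;> rfl,
      prod_ite, prod_const, prod_const, filter_filter, filter_filter, fp, twoCycles]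
    congr 3 <;> ext a <;> simp only [mem_filter, mem_univ, true_and]
    · exact ⟨fun h => ⟨h.ge, h⟩, fun h => h.2⟩
    · rw [lt_iff_le_and_ne, ne_comm]
  have hmin : ∀ a, min a (σ a) ∈ univ.filter (fun a => a ≤ σ a) := by
    intro a
    rw [mem_filter]
    refine ⟨mem_univ _, ?_⟩
    rcases le_total a (σ a) with h | h
    · rw [min_eq_left h]; exact h
    · rw [min_eq_right h, hσ' a]; exact h
  have hcongr : ∀ (p : ∀ a ∈ univ.filter (fun a => a ≤ σ a), ι) (a b : Fin m) (ha hb),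
      a = b → p a ha = p b hb := by
    rintro p a _ ha hb rfl
    rfl
  rw [h1, prod_sum]
  refine sum_bij' (fun p _ a => p (min a (σ a)) (hmin a)) (fun d _ a _ => d a) ?_ ?_ ?_ ?_ ?_
  · intro p hp
    rw [mem_pi] at hp
    rw [mem_filter, Fintype.mem_piFinset]
    refine ⟨fun a => hp _ _, fun a => hcongr p _ _ _ _ ?_⟩
    rw [hσ' a, min_comm]
  · intro d hd
    rw [mem_filter, Fintype.mem_piFinset] at hd
    rw [mem_pi]
    exact fun a _ => hd.1 a
  · intro p _
    funext a ha
    exact hcongr p _ _ _ _ (min_eq_left (mem_filter.1 ha).2)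
  · intro d hd
    rw [mem_filter] at hd
    funext a
    rcases le_total a (σ a) with h | h
    · simp only [min_eq_left h]
    · simp only [min_eq_right h, hd.2]
  · intro p _
    rw [← prod_attach (univ.filter fun a => a ≤ σ a)]
    refine prod_congr rfl fun a _ => ?_
    beta_reduce
    rw [hcongr p _ _ (hmin a) a.2 (min_eq_left (mem_filter.1 a.2).2)]

theorem sum_orbit_sizes {m : ℕ} {σ : Perm (Fin m)} (hσ : σ ∈ involutions m) {k : Fin m → ℕ}
    (hk : ∀ a, k (σ a) = k a) :
    ∑ a ∈ univ.filter (fun a => a ≤ σ a), (if σ a = a then k a else 2 * k a) = ∑ a, k a := by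
  have hσ' := mem_involutions.1 hσ
  have h1 : ∑ a ∈ univ.filter (fun a => ¬ a ≤ σ a), k a =
      ∑ a ∈ univ.filter (fun a => a < σ a), k a := by
    refine sum_bij (fun a _ => σ a) ?_ (fun a _ b _ h => σ.injective h) ?_ fun a _ => (hk a).symm
    · intro a ha
      simpa [hσ' a] using ha
    · intro a ha
      exact ⟨σ a, by simpa [hσ' a] using ha, hσ' a⟩
  rw [← sum_filter_add_sum_filter_not univ (fun a => a ≤ σ a), h1, sum_filter, sum_filter,
    sum_filter, ← sum_add_distrib]
  refine sum_congr rfl fun a _ => ?_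
  rcases lt_trichotomy a (σ a) with h | h | h
  · rw [if_pos h.le, if_neg h.ne', if_pos h.le, if_pos h]; ring
  · rw [if_pos h.le, if_pos h.symm, if_pos h.le, if_neg h.not_lt]; ring
  · rw [if_neg (not_le.2 h), if_neg (not_le.2 h), if_neg h.not_gt, add_zero]

/-- A sum over compositions of `n` as a sum over tuples of positive numbers of sum `n`. -/
theorem sum_composition_eq {M : Type*} [AddCommMonoid M] (n : ℕ) (G : (m : ℕ) → (Fin m → ℕ) → M) :
    ∑ c : Composition n, G c.length c.blocksFun = ∑ m ∈ range (n + 1),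
      ∑ k ∈ (Fintype.piFinset fun _ : Fin m => Icc 1 n).filter (fun k => ∑ a, k a = n), G m k := by
  rw [sum_sigma']
  refine sum_bij (fun c _ => (⟨c.length, c.blocksFun⟩ : (m : ℕ) × (Fin m → ℕ))) ?_ ?_ ?_ ?_
  · intro c _
    rw [mem_sigma, mem_range, mem_filter, Fintype.mem_piFinset]
    exact ⟨Nat.lt_succ_of_le c.length_le,
      fun a => mem_Icc.2 ⟨c.one_le_blocksFun a, c.blocksFun_le a⟩, c.sum_blocksFun⟩
  · intro c _ c' _ h
    have := congrArg (fun p : (m : ℕ) × (Fin m → ℕ) => List.ofFn p.2) h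
    simp only [Composition.ofFn_blocksFun] at this
    exact Composition.ext this
  · rintro ⟨m, k⟩ h
    rw [mem_sigma, mem_filter, Fintype.mem_piFinset] at h
    refine ⟨⟨List.ofFn k, ?_, ?_⟩, mem_univ _, List.equivSigmaTuple.apply_symm_apply ⟨m, k⟩⟩
    · intro i hi
      obtain ⟨a, rfl⟩ := (List.mem_ofFn' k i).1 hi
      exact (mem_Icc.1 (h.2.1 a)).1
    · rw [List.sum_ofFn]; exact h.2.2
  · exact fun _ _ => rfl

end Decorated

/-! ### The series of blocks -/

section BlockSeries

variable {R : Type*} [CommRing R]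

/-- The types of blocks of size at most `n`: a size and a direction, which is `true` if the size
is one. -/
def blockTypes (n : ℕ) : Finset (ℕ × Bool) :=
  (Icc 1 n ×ˢ univ).filter fun k => k.1 = 1 → k.2 = true

theorem sum_blockTypes {M : Type*} [AddCommMonoid M] (n : ℕ) (f : ℕ × Bool → M) :
    ∑ k ∈ blockTypes n, f k =
      ∑ k ∈ Icc 1 n, (f (k, true) + if k = 1 then 0 else f (k, false)) := by
  rw [blockTypes, sum_filter, sum_product]
  refine sum_congr rfl fun k _ => ?_
  rw [Fintype.sum_bool]
  by_cases h : k = 1 <;> simp [h]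

theorem serA_eq (t u₁ u₂ v₂ : R) : serA t u₁ u₂ v₂ =
    X * C t + clusterSeries t (u₁ - 1) (u₂ - 1) (v₂ ^ 2 - 1) := by
  rw [serA, clusterSeries, add_assoc]
  simp only [map_sub, map_pow, map_one]

theorem X_dvd_serA (t u₁ u₂ v₂ : R) : X ∣ serA t u₁ u₂ v₂ := by
  rw [X_dvd_iff, ← coeff_zero_eq_constantCoeff_apply, serA_eq, map_add, coeff_clusterSeries]
  simp

/-- The coefficients of `A` are the weights of the blocks that are mapped to themselves. -/
theorem X_pow_dvd_serA_sub (t u₁ u₂ v₂ : R) (n : ℕ) : X ^ (n + 1) ∣ serA t u₁ u₂ v₂ -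
    ∑ k ∈ blockTypes n, C (fixedBlockWeight t (u₁ - 1) (u₂ - 1) (v₂ ^ 2 - 1) k) * X ^ k.1 := by
  rw [X_pow_dvd_iff]
  intro j hj
  rw [map_sub, sub_eq_zero, sum_blockTypes, map_sum, serA_eq, map_add, coeff_clusterSeries,
    mul_comm X, coeff_C_mul]
  have h1 : ∀ k ∈ Icc 1 n, coeff j (C (fixedBlockWeight t (u₁ - 1) (u₂ - 1) (v₂ ^ 2 - 1) (k, true)) *
      X ^ k + if k = 1 then 0 else
        C (fixedBlockWeight t (u₁ - 1) (u₂ - 1) (v₂ ^ 2 - 1) (k, false)) * X ^ k) =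
      if j = k then (fixedBlockWeight t (u₁ - 1) (u₂ - 1) (v₂ ^ 2 - 1) (k, true) +
        if k = 1 then 0 else fixedBlockWeight t (u₁ - 1) (u₂ - 1) (v₂ ^ 2 - 1) (k, false)) else 0 := by
    intro k _
    rw [map_add, apply_ite (coeff j), map_zero, coeff_C_mul, coeff_C_mul, coeff_X_pow]
    split_ifs <;> simp
  rw [sum_congr rfl h1, sum_ite_eq]
  match j, hj with
  | 0, _ => simp
  | 1, hj =>
    rw [if_pos (by omega), if_pos (mem_Icc.2 (by omega))]
    simp [fixedBlockWeight]
  | j + 2, hj =>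
    rw [if_neg (by omega), if_pos (mem_Icc.2 (by omega)), if_neg (by omega), coeff_X,
      if_neg (by omega)]
    simp [fixedBlockWeight]

/-- The coefficient at `2k` counts both directions; a pair of single positions, which has no
direction, is counted once, hence the subtraction. -/
theorem serB_eq_mk_add_mk_sub (v₁ v₂ : R) : serB v₁ v₂ =
    PowerSeries.mk (fun k => if k < 2 then 0 else reversalWeight 0 1 (v₁ ^ 2 - 1) k) +
    PowerSeries.mk (fun k => if k < 2 then 0 else reversalWeight 0 1 (v₂ ^ 2 - 1) k) - X ^ 2 := by
  have h : ∀ q : R, PowerSeries.mk (fun k => if k < 2 then 0 else reversalWeight 0 1 q k) =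
      X ^ 2 + frac (X ^ 4 * C q) (1 - X ^ 2 * C q) := by
    intro q
    rw [mk_decreasing_eq]
    refine (eq_frac_of_mul_eq (by simp) ?_).symm
    rw [add_mul, frac_mul_cancel (by simp), map_one, map_zero]
    ring
  rw [serB_eq, h, h]
  simp only [map_sub, map_pow, map_one]
  ring

theorem X_sq_dvd_serB (v₁ v₂ : R) : X ^ 2 ∣ serB v₁ v₂ := by
  rw [serB_eq_mk_add_mk_sub]
  refine dvd_sub (dvd_add ?_ ?_) dvd_rfl <;>
  · rw [X_pow_dvd_iff]
    intro j hj
    rw [coeff_mk, if_pos hj]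

/-- The coefficients of `B` are the weights of the pairs of exchanged blocks. -/
theorem X_pow_dvd_serB_sub (v₁ v₂ : R) (n : ℕ) : X ^ (n + 1) ∣ serB v₁ v₂ -
    ∑ k ∈ blockTypes n,
      C (swappedBlockWeight (v₁ ^ 2 - 1) (v₂ ^ 2 - 1) k) * X ^ (2 * k.1) := by
  rw [X_pow_dvd_iff]
  intro j hj
  rw [map_sub, sub_eq_zero, sum_blockTypes, map_sum, serB_eq_mk_add_mk_sub, map_sub, map_add,
    coeff_mk, coeff_mk, coeff_X_pow]
  have h1 : ∀ k ∈ Icc 1 n, coeff j (C (swappedBlockWeight (v₁ ^ 2 - 1) (v₂ ^ 2 - 1) (k, true)) *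
      X ^ (2 * k) + if k = 1 then 0 else
        C (swappedBlockWeight (v₁ ^ 2 - 1) (v₂ ^ 2 - 1) (k, false)) * X ^ (2 * k)) =
      if j = 2 * k then ((v₁ ^ 2 - 1) ^ (k - 1) +
        if k = 1 then 0 else (v₂ ^ 2 - 1) ^ (k - 1)) else 0 := by
    intro k _
    rw [map_add, apply_ite (coeff j), map_zero, coeff_C_mul, coeff_C_mul, coeff_X_pow]
    split_ifs <;> simp [swappedBlockWeight]
  rw [sum_congr rfl h1]
  rcases Nat.even_or_odd' j with ⟨h, rfl | rfl⟩
  · cases h with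
    | zero =>
      rw [sum_eq_zero fun k hk => if_neg (by rw [mem_Icc] at hk; omega)]
      simp
    | succ h =>
      rw [sum_eq_single_of_mem (h + 1) (mem_Icc.2 ⟨by omega, by omega⟩) fun k _ hk => if_neg (by omega),
        if_neg (by omega), if_neg (by omega), if_pos rfl, mul_add, mul_one,
        reversalWeight_even, reversalWeight_even]
      cases h with
      | zero => simp
      | succ h => simp
  · rw [sum_eq_zero fun k _ => if_neg (by omega),
      if_neg (show ¬ 2 * h + 1 = 2 by omega)]
    simp [reversalWeight_odd]

theorem coeff_pow_mul_pow_congr {n : ℕ} {A A' B B' : R⟦X⟧} (hA : X ^ (n + 1) ∣ A - A')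
    (hB : X ^ (n + 1) ∣ B - B') (p q : ℕ) : coeff n (A ^ p * B ^ q) = coeff n (A' ^ p * B' ^ q) := by
  have h : X ^ (n + 1) ∣ A ^ p * B ^ q - A' ^ p * B' ^ q := by
    have e : A ^ p * B ^ q - A' ^ p * B' ^ q =
        (A ^ p - A' ^ p) * B ^ q + A' ^ p * (B ^ q - B' ^ q) := by ring
    rw [e]
    exact dvd_add ((hA.trans (sub_dvd_pow_sub_pow A A' p)).mul_right _)
      ((hB.trans (sub_dvd_pow_sub_pow B B' q)).mul_left _)
  have := X_pow_dvd_iff.1 h n (Nat.lt_succ_self n)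
  rwa [map_sub, sub_eq_zero] at this

theorem coeff_prod_monomials {m : ℕ} {σ : Perm (Fin m)} (hσ : σ ∈ involutions m)
    {k : Fin m → ℕ × Bool} (hk : ∀ a, k (σ a) = k a) (f g : ℕ × Bool → R) (n : ℕ) :
    coeff n (∏ a ∈ univ.filter (fun a => a ≤ σ a),
      (if σ a = a then C (f (k a)) * X ^ (k a).1 else C (g (k a)) * X ^ (2 * (k a).1))) =
    if ∑ a, (k a).1 = n then ∏ a ∈ univ.filter (fun a => a ≤ σ a),
      (if σ a = a then f (k a) else g (k a)) else 0 := by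
  have h1 : ∀ a, (if σ a = a then C (f (k a)) * X ^ (k a).1
      else C (g (k a)) * X ^ (2 * (k a).1) : R⟦X⟧) =
      C (if σ a = a then f (k a) else g (k a)) *
        X ^ (if σ a = a then (k a).1 else 2 * (k a).1) := by
    intro a; split_ifs <;> rfl
  rw [prod_congr rfl fun a _ => h1 a, prod_mul_distrib, ← map_prod, prod_pow_eq_pow_sum,
    sum_orbit_sizes hσ (k := fun a => (k a).1) fun a => by rw [hk], coeff_C_mul, coeff_X_pow,
    mul_ite, mul_one, mul_zero]
  exact if_congr eq_comm rfl rfl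

/-- Substituting the series of blocks into the weight of an involution of `m` points amounts to
inflating the points to blocks. -/
theorem sum_blockSum_eq_coeff (t u₁ u₂ v₁ v₂ : R) (n m : ℕ) :
    ∑ k ∈ (Fintype.piFinset fun _ : Fin m => Icc 1 n).filter (fun k => ∑ a, k a = n),
      blockSum t (u₁ - 1) (u₂ - 1) (v₁ ^ 2 - 1) (v₂ ^ 2 - 1) m k =
    coeff n (involutionPoly (serA t u₁ u₂ v₂) (serB v₁ v₂) m) := by
  classical
  rw [← sum_involutions_eq, map_sum]
  simp only [blockSum]
  rw [sum_comm]
  refine sum_congr rfl fun σ hσ => ?_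
  rw [coeff_pow_mul_pow_congr (X_pow_dvd_serA_sub t u₁ u₂ v₂ n) (X_pow_dvd_serB_sub v₁ v₂ n),
    pow_fp_mul_pow_twoCycles hσ, map_sum,
    sum_congr rfl fun k hk => coeff_prod_monomials hσ (mem_filter.1 hk).2 _ _ n,
    ← sum_filter, ← sum_product', ← sum_filter]
  refine sum_bij' (fun p _ a => (p.1 a, p.2 a)) (fun e _ => (fun a => (e a).1, fun a => (e a).2))
    ?_ ?_ (fun _ _ => rfl) (fun _ _ => rfl) (fun _ _ => rfl)
  · rintro ⟨k, d⟩ hp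
    simp only [mem_filter, mem_product, Fintype.mem_piFinset, mem_univ, and_true, blockTypes,
      Prod.mk.injEq] at hp ⊢
    obtain ⟨⟨h1, h2⟩, h3, h4, h5⟩ := hp
    exact ⟨⟨fun a => ⟨h1 a, h5 a⟩, fun a => ⟨h3 a, h4 a⟩⟩, h2⟩
  · intro e he
    simp only [mem_filter, mem_product, Fintype.mem_piFinset, mem_univ, and_true, blockTypes]
      at he ⊢
    obtain ⟨⟨h1, h2⟩, h3⟩ := he
    exact ⟨⟨fun a => (h1 a).1, h3⟩, fun a => congrArg Prod.fst (h2 a),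
      fun a => congrArg Prod.snd (h2 a), fun a => (h1 a).2⟩

theorem isContinuedFraction_involutionGF (t u₁ u₂ v₁ v₂ : R) :
    IsContinuedFraction (involutionGF t u₁ u₂ v₁ v₂) (serA t u₁ u₂ v₂) (serB v₁ v₂) := by
  refine isContinuedFraction_of_coeff (X_dvd_serA t u₁ u₂ v₂) (X_sq_dvd_serB v₁ v₂) fun n => ?_
  rw [coeff_involutionGF, sum_composition_eq n
    (blockSum t (u₁ - 1) (u₂ - 1) (v₁ ^ 2 - 1) (v₂ ^ 2 - 1))]
  exact sum_congr rfl fun m _ => sum_blockSum_eq_coeff t u₁ u₂ v₁ v₂ n m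

end BlockSeries
end Hertzsprung

open Classical in
theorem mainTheorem3 {R : Type*} [CommRing R] :
    -- the clusters are `12⋯n` and `n⋯21` (`n ≥ 2`) with all occurrences marked
    (∀ (n : ℕ) (π : Perm (Fin n)) (M : Finset (ℕ × ℕ)), IsCluster T₂ π M ↔
      2 ≤ n ∧ ((π = 1 ∧ M = (range (n - 1)).image fun j => (j, j)) ∨
        (π = Fin.revPerm ∧ M = (range (n - 1)).image fun j => (j, n - 2 - j)))) ∧
    -- every cluster is involutory
    (∀ (n : ℕ) (π : Perm (Fin n)) (M : Finset (ℕ × ℕ)), IsCluster T₂ π M → π ∈ involutions n) ∧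
    -- the cluster generating functions
    (∀ a₁ a₂ : R, clusterGF a₁ a₂ = involutoryClusterGF 1 a₁ a₂ a₁ a₂) ∧
    (∀ t u₁ u₂ v₁ v₂ : R, involutoryClusterGF t u₁ u₂ v₁ v₂ =
      frac (X ^ 2 * C t ^ 2 * C u₁) (1 - X * C t * C u₁) +
        frac ((C u₂ + X * C t * C v₂ ^ 2) * X ^ 2) (1 - X ^ 2 * C v₂ ^ 2)) ∧
    -- the continued fraction, and the second expression of `B`
    (∀ t u₁ u₂ v₁ v₂ : R,
      IsContinuedFraction (involutionGF t u₁ u₂ v₁ v₂) (serA t u₁ u₂ v₂) (serB v₁ v₂)) ∧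
    (∀ v₁ v₂ : R, serB v₁ v₂ =
      X ^ 2 + frac (X ^ 4 * (C v₁ ^ 2 - 1)) (1 - X ^ 2 * (C v₁ ^ 2 - 1)) +
        frac (X ^ 4 * (C v₂ ^ 2 - 1)) (1 - X ^ 2 * (C v₂ ^ 2 - 1))) ∧
    -- the specializations
    (PowerSeries.mk (fun n =>
        (((involutions n).filter fun π => IsHertzsprungAvoiding π).card : R)) =
      involutionGF 1 0 0 0 0) ∧
    (PowerSeries.mk (fun n => (((involutions n).filter fun π => IsIrreducible π).card : R)) =
      involutionGF 1 0 1 0 1) ∧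
    (PowerSeries.mk (fun n => (((involutions n).filter fun π =>
        IsIrreducible π ∧ ∀ i, π i ≠ i).card : R)) =
      involutionGF 0 0 1 0 1) ∧
    (∀ u₂ : R, PowerSeries.mk (fun n => ∑ π ∈ perfectMatchings n, u₂ ^ shortPairs π) =
      involutionGF 0 1 u₂ 1 1) := by
  refine ⟨isCluster_iff, fun n π M h => h.mem_involutions, clusterGF_eq, ?_,
    isContinuedFraction_involutionGF, serB_eq, mk_hertzsprung_eq, mk_irreducible_eq,
    mk_irreducible_derangement_eq, mk_shortPairs_eq⟩
  intro t u₁ u₂ v₁ v₂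
  rw [involutoryClusterGF_eq_clusterSeries, clusterSeries, map_pow]
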